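/- Let $A_1,\dots,A_m\in\mathbb{R}^{n\times n}$ ($m\ge1$), $\mathcal A(M)=(\langle A_1,M\rangle,\dots,\langle A_m,M\rangle)$, let $1\le r^\star\le r$, let $M^\star\in\mathbb{R}^{n\times n}$ be positive semidefinite of rank $r^\star$, and suppose that $\mathcal A$ satisfies the restricted isometry property with parameters $(2r,\delta)$, $0\le\delta<1$: $(1-\delta)\|M\|_F^2\le\frac1m\|\mathcal A(M)\|^2\le(1+\delta)\|M\|_F^2$ for all $M\in\mathbb{R}^{n\times n}$ of rank at most $2r$. The measurements are $y=\mathcal A(M^\star)+\epsilon$, where $\epsilon\in\mathbb{R}^m$ has independent sub-Gaussian entries of mean zero; with $\sigma\ge0$ given by $\sigma^2=\frac1m\sum_{i=1}^m\mathbb{E}[\epsilon_i^2]$, this means that for a constant $\kappa$ we have $\mathbb{E}\,e^{t\epsilon_i}\le e^{\kappa\sigma^2t^2/2}$ for all $i$ and $t\in\mathbb{R}$. Let $f(X)=\frac1m\|y-\mathcal A(XX^T)\|^2$ for $X\in\mathbb{R}^{n\times r}$, and for a step size $\alpha>0$ consider the iterates $$X_{k+1}=X_k-\alpha\nabla f(X_k)(X_k^TX_k+\eta_kI_r)^{-1},\qquad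 \eta_k=\tfrac1{\sqrt m}\|\mathcal A(X_kX_k^T-M^\star)\|.$$ Let $0<\rho<1$ with $\frac{\rho^2}{1-\rho^2}\le\frac{1-\delta^2}2$, and let $$\mu_P=\Bigl(\sqrt{\tfrac{1+\delta^2}2}-\delta\Bigr)^2\min\Bigl\{\Bigl(1+\tfrac{\sqrt{1+\delta}}{\sqrt2-1}\Bigr)^{-1},\Bigl(1+3\sqrt{1+\delta}\sqrt{\tfrac{r-r^\star}{1-\delta^2}}\Bigr)^{-1}\Bigr\}.$$ Then there are a number $L>0$ that depends only on $\delta$, and constants $C,c,c'>0$ that depend only on $\kappa$, such that if $\alpha\le1/L$, then for every $K\ge0$, with probability at least $1-cn^{-c'}$, the following holds for every starting point $X_0$ (which may depend on $\epsilon$) with $$\tfrac1m\|\mathcal A(X_0X_0^T-M^\star)\|^2<\rho^2(1-\delta)\lambda_{r^\star}(M^\star)^2:$$ every $k^\star\in\arg\min_{0\le k\le K}\eta_k$ satisfies $$\|X_{k^\star}X_{k^\star}^T-M^\star\|_F^2\le C\max\Bigl\{\frac{1+\delta}{1-\delta}\Bigl(1-\alpha\frac{\mu_P}2\Bigr)^K\|X_0X_0^T-M^\star\|_F^2,\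 \frac{\sigma^2nr\log n}{\mu_P(1-\delta)m}\Bigr\}.$$ (If $\eta_k=0$ for some $k\le K$, the iteration may be stopped or continued arbitrarily after the first such $k$.) -/

import Mathlib

open MeasureTheory ProbabilityTheory
open scoped NNReal ENNReal Matrix

/- Matrices carry the Frobenius norm. -/
attribute [local instance] Matrix.frobeniusNormedAddCommGroup

noncomputable section

namespace PrecGD

/-- The linear measurement operator `𝒜(M) = (⟨A₁, M⟩, …, ⟨A_m, M⟩)`, with `⟨A, M⟩ = tr(Aᵀ M)`,
as a vector of Euclidean space. -/
def sensing {n m : ℕ} (A : Fin m → Matrix (Fin n) (Fin n) ℝ) (M : Matrix (Fin n) (Fin n) ℝ) :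
    EuclideanSpace ℝ (Fin m) :=
  WithLp.toLp 2 (fun i => ((A i)ᵀ * M).trace)

/-- Restricted isometry property with parameters `(s, δ)`. -/
def RIP {n m : ℕ} (A : Fin m → Matrix (Fin n) (Fin n) ℝ) (s : ℕ) (δ : ℝ) : Prop :=
  ∀ M : Matrix (Fin n) (Fin n) ℝ, M.rank ≤ s →
    (1 - δ) * ‖M‖ ^ 2 ≤ (1 / (m : ℝ)) * ‖sensing A M‖ ^ 2 ∧
      (1 / (m : ℝ)) * ‖sensing A M‖ ^ 2 ≤ (1 + δ) * ‖M‖ ^ 2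

/-- The empirical loss `f(X) = (1/m) ‖y - 𝒜(X Xᵀ)‖²`. -/
def loss {n m r : ℕ} (A : Fin m → Matrix (Fin n) (Fin n) ℝ) (y : EuclideanSpace ℝ (Fin m))
    (X : Matrix (Fin n) (Fin r) ℝ) : ℝ :=
  (1 / (m : ℝ)) * ‖y - sensing A (X * Xᵀ)‖ ^ 2

/-- The gradient of a function of a matrix: the matrix of its partial derivatives. -/
def grad {n r : ℕ} (f : Matrix (Fin n) (Fin r) ℝ → ℝ) (X : Matrix (Fin n) (Fin r) ℝ) :
    Matrix (Fin n) (Fin r) ℝ :=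
  Matrix.of fun i j => lineDeriv ℝ f X (Matrix.single i j 1)

/-- The damping parameter `η(X) = ‖𝒜(X Xᵀ - M⋆)‖ / √m`. -/
def damping {n m r : ℕ} (A : Fin m → Matrix (Fin n) (Fin n) ℝ) (Mstar : Matrix (Fin n) (Fin n) ℝ)
    (X : Matrix (Fin n) (Fin r) ℝ) : ℝ :=
  (1 / √(m : ℝ)) * ‖sensing A (X * Xᵀ - Mstar)‖

/-- The iterates of preconditioned gradient descent on the loss with measurements `y`:
`X_{k+1} = X_k - α ∇f(X_k) (X_kᵀ X_k + η_k I_r)⁻¹`, with `η_k = ‖𝒜(X_k X_kᵀ - M⋆)‖ / √m`. -/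
def iterate {n m r : ℕ} (A : Fin m → Matrix (Fin n) (Fin n) ℝ)
    (Mstar : Matrix (Fin n) (Fin n) ℝ) (y : EuclideanSpace ℝ (Fin m)) (α : ℝ)
    (X₀ : Matrix (Fin n) (Fin r) ℝ) : ℕ → Matrix (Fin n) (Fin r) ℝ
  | 0 => X₀
  | k + 1 =>
    let X := iterate A Mstar y α X₀ k
    X - α • (grad (loss A y) X *
      (Xᵀ * X + damping A Mstar X • (1 : Matrix (Fin r) (Fin r) ℝ))⁻¹)

/-- The `k`-th largest eigenvalue `λ_k(M)`, `1 ≤ k ≤ n`, of a symmetric matrix, counted with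
multiplicity (`0` outside this range). -/
def eigval {n : ℕ} (M : Matrix (Fin n) (Fin n) ℝ) (k : ℕ) : ℝ :=
  open Classical in
  if h : M.IsHermitian ∧ 1 ≤ k ∧ k ≤ n then
    h.1.eigenvalues₀ ⟨k - 1, by rw [Fintype.card_fin]; omega⟩
  else 0

/-- The gradient dominance constant `μ_P`, for a damping parameter that is at most `Cub` times the
error `‖X Xᵀ - M⋆‖_F`. -/
def muPL (Cub δ : ℝ) (r rstar : ℕ) : ℝ :=
  (√((1 + δ ^ 2) / 2) - δ) ^ 2 *
    min (1 + Cub / (√2 - 1))⁻¹ (1 + 3 * Cub * √(((r : ℝ) - rstar) / (1 - δ ^ 2)))⁻¹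

/-- The gradient dominance constant `μ_P` for `η = ‖𝒜(X Xᵀ - M⋆)‖ / √m`, which under the restricted
isometry property is at most `√(1 + δ) ‖X Xᵀ - M⋆‖_F`. -/
def muP (δ : ℝ) (r rstar : ℕ) : ℝ := muPL √(1 + δ) δ r rstar

/-- The statistical error `σ² n r log n / (μ_P (1 - δ) m)`. -/
def statError (σ δ : ℝ) (n m r rstar : ℕ) : ℝ :=
  σ ^ 2 * n * r * Real.log n / (muP δ r rstar * (1 - δ) * m)

end PrecGD

end

/-!
# Preconditioned gradient descent with noisy measurements

The argument follows the noiseless loss `η_k² = b(E_k, E_k)`, where `E_k = X_k X_kᵀ - M⋆` and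
`b(M, N) = ⟨𝒜 M, 𝒜 N⟩ / m`, along the iteration driven by the noisy gradient. Gradients are measured
in the dual of the preconditioned norm `‖U‖_P² = ‖U Xᵀ‖² + η ‖U‖²` (`pip`), so that the step
direction is the Riesz representative of the gradient (`pip_mul_inv`).

*Gradient dominance* (`two_mul_muP_mul_sq_le`). Let `P` be the spectral projection of `X Xᵀ` onto
its eigenvalues at least `t`, where `t` is a suitable multiple of `‖E‖`, and let `Q = 1 - P`. A
dimension count shows that at most `r - r⋆` nonzero eigenvalues of `X Xᵀ` are left out, so
`Q X Xᵀ Q` is small; the spectral gap of `M⋆` forces `‖Q M⋆ Q‖` to be of second order in the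
off-diagonal block `P M⋆ Q = -P E Q`. Together these give `‖Q E Q‖² ≤ (1 - δ²) / 2 ‖E‖²`
(`norm_compl_block_sq_le`). Hence `E - Q E Q`, which is the derivative of `X Xᵀ` in a direction `Y`
with `‖Y‖_P` under control, makes a small angle with `E`, and the restricted isometry property
transfers this angle to the form `b`. With this choice of `t` the squared gradient norm is at least
`2 μ_P η²`, four times more than the rate `μ_P / 2` requires, which leaves room for the noise and
the second-order terms.

*Descent* (`bform_step_le`). The loss is a quartic polynomial in the step. Since `η ‖D‖² ≤ ‖D‖_P²`,
the terms of second and higher order are at most a universal constant times `α² ‖D‖_P²`, which is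
why the step size bound `1 / 4000` does not even depend on `δ`. As long as the noise part of the
gradient satisfies `‖·‖_P² ≤ μ_P η² / 4`, a step multiplies the loss by at most `1 - α μ_P / 2`.

*Noise* (`pip_noise_le`, `measure_noise_large_le`). The noise part of the gradient has squared
preconditioned norm at most `16 r ω² / m²`, where `ω` is the operator norm of `∑ ε_i A_i`. A union
bound over a grid with `(8 n + 1)ⁿ` points, whose cardinality the factor `log n` pays for, gives
`ω² ≤ 176 (κ + 1) σ² m n log n` outside an event of probability at most `1 / n`.

On this event either some iterate has reached the noise level, and then so has the one of smallest
`η_k`, or all steps up to `K` contract (`norm_error_sq_le`).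
-/

namespace PrecGD

/-! ### The Frobenius inner product -/

section Frobenius

variable {n m k : ℕ}

/-- The Frobenius inner product `⟨A, B⟩ = ∑ A i j * B i j`, as a bilinear form; its quadratic form
is the square of the Frobenius norm. -/
def fip : LinearMap.BilinForm ℝ (Matrix (Fin n) (Fin k) ℝ) :=
  LinearMap.mk₂ ℝ (fun A B => ∑ i, ∑ j, A i j * B i j)
    (fun A B C => by simp [add_mul, Finset.sum_add_distrib])
    (fun c A B => by simp [Finset.mul_sum, mul_assoc])
    (fun A B C => by simp [mul_add, Finset.sum_add_distrib])
    (fun c A B => by simp [Finset.mul_sum, mul_left_comm])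

lemma fip_apply (A B : Matrix (Fin n) (Fin k) ℝ) : fip A B = ∑ i, ∑ j, A i j * B i j := rfl

lemma fip_comm (A B : Matrix (Fin n) (Fin k) ℝ) : fip A B = fip B A := by
  simp [fip_apply, mul_comm]

lemma fip_self (A : Matrix (Fin n) (Fin k) ℝ) : fip A A = ‖A‖ ^ 2 := by
  have h : (0 : ℝ) ≤ ∑ i, ∑ j, A i j ^ 2 :=
    Finset.sum_nonneg fun i _ => Finset.sum_nonneg fun j _ => sq_nonneg _
  rw [Matrix.frobenius_norm_def, fip_apply]
  simp only [Real.norm_eq_abs, Real.rpow_two, sq_abs, ← Real.sqrt_eq_rpow, Real.sq_sqrt h]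
  simp [sq]

lemma fip_self_nonneg (A : Matrix (Fin n) (Fin k) ℝ) : 0 ≤ fip A A := by
  rw [fip_self]; positivity

lemma fip_eq_trace (A B : Matrix (Fin n) (Fin k) ℝ) : fip A B = (Aᵀ * B).trace := by
  rw [fip_apply, Finset.sum_comm]
  simp [Matrix.trace, Matrix.mul_apply]

lemma fip_transpose (A B : Matrix (Fin n) (Fin k) ℝ) : fip Aᵀ Bᵀ = fip A B := by
  rw [fip_apply, fip_apply, Finset.sum_comm]; rfl

lemma fip_transpose_right (A : Matrix (Fin n) (Fin k) ℝ) (B : Matrix (Fin k) (Fin n) ℝ) :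
    fip A Bᵀ = fip Aᵀ B := by
  rw [← fip_transpose A, Matrix.transpose_transpose]

lemma fip_mul_left (A : Matrix (Fin n) (Fin m) ℝ) (B : Matrix (Fin m) (Fin k) ℝ)
    (C : Matrix (Fin n) (Fin k) ℝ) : fip (A * B) C = fip B (Aᵀ * C) := by
  rw [fip_eq_trace, fip_eq_trace, Matrix.transpose_mul, Matrix.mul_assoc]

lemma fip_mul_right (A : Matrix (Fin n) (Fin m) ℝ) (B : Matrix (Fin m) (Fin k) ℝ)
    (C : Matrix (Fin n) (Fin k) ℝ) : fip (A * B) C = fip A (C * Bᵀ) := by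
  rw [fip_eq_trace, fip_eq_trace, Matrix.transpose_mul, Matrix.mul_assoc,
    Matrix.trace_mul_comm, Matrix.mul_assoc]

lemma fip_vecMulVec (A : Matrix (Fin n) (Fin k) ℝ) (u : Fin n → ℝ) (v : Fin k → ℝ) :
    fip A (Matrix.vecMulVec u v) = u ⬝ᵥ A *ᵥ v := by
  simp only [fip_apply, Matrix.vecMulVec_apply, dotProduct, Matrix.mulVec, Finset.mul_sum]
  exact Finset.sum_congr rfl fun i _ => Finset.sum_congr rfl fun j _ => by ring

/-- The Cauchy-Schwarz inequality for the Frobenius inner product. -/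
lemma fip_le (A B : Matrix (Fin n) (Fin k) ℝ) : fip A B ≤ ‖A‖ * ‖B‖ := by
  have h := fip.apply_sq_le_of_symm fip_self_nonneg ⟨fip_comm⟩ A B
  rw [fip_self, fip_self, ← mul_pow] at h
  exact le_of_sq_le_sq h (by positivity)

lemma norm_mul_transpose_le (D : Matrix (Fin n) (Fin k) ℝ) : ‖D * Dᵀ‖ ≤ ‖D‖ ^ 2 := by
  calc ‖D * Dᵀ‖ ≤ ‖D‖ * ‖Dᵀ‖ := Matrix.frobenius_norm_mul _ _
    _ = ‖D‖ ^ 2 := by rw [Matrix.frobenius_norm_transpose, sq]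

lemma norm_vecMulVec_sq (u : Fin n → ℝ) (v : Fin k → ℝ) :
    ‖Matrix.vecMulVec u v‖ ^ 2 = (u ⬝ᵥ u) * (v ⬝ᵥ v) := by
  rw [← fip_self, fip_apply, dotProduct, dotProduct, Finset.sum_mul_sum]
  exact Finset.sum_congr rfl fun i _ => Finset.sum_congr rfl fun j _ => by
    rw [Matrix.vecMulVec_apply]; ring

lemma norm_smul_sq (c : ℝ) (A : Matrix (Fin n) (Fin k) ℝ) : ‖c • A‖ ^ 2 = c ^ 2 * ‖A‖ ^ 2 := by
  rw [← fip_self, ← fip_self]; simp; ring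

lemma norm_add_sq (A B : Matrix (Fin n) (Fin k) ℝ) :
    ‖A + B‖ ^ 2 = ‖A‖ ^ 2 + 2 * fip A B + ‖B‖ ^ 2 := by
  rw [← fip_self, ← fip_self, ← fip_self]; simp [fip_comm B A]; ring

lemma norm_sub_sq (A B : Matrix (Fin n) (Fin k) ℝ) :
    ‖A - B‖ ^ 2 = ‖A‖ ^ 2 - 2 * fip A B + ‖B‖ ^ 2 := by
  rw [← fip_self, ← fip_self, ← fip_self]; simp [fip_comm B A]; ring

end Frobenius

/-! ### The measurement form and the restricted isometry property -/

section Measurement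

variable {n m r : ℕ} {A : Fin m → Matrix (Fin n) (Fin n) ℝ} {δ : ℝ} {s : ℕ}

lemma sensing_apply (A : Fin m → Matrix (Fin n) (Fin n) ℝ) (M : Matrix (Fin n) (Fin n) ℝ)
    (i : Fin m) : sensing A M i = fip (A i) M := by
  rw [fip_eq_trace]; rfl

/-- The measurement operator as a linear map. -/
def sensingLin (A : Fin m → Matrix (Fin n) (Fin n) ℝ) :
    Matrix (Fin n) (Fin n) ℝ →ₗ[ℝ] EuclideanSpace ℝ (Fin m) where
  toFun := sensing A
  map_add' M N := by ext i; simp [sensing_apply]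
  map_smul' c M := by ext i; simp [sensing_apply]

lemma sensing_add (M N : Matrix (Fin n) (Fin n) ℝ) :
    sensing A (M + N) = sensing A M + sensing A N := (sensingLin A).map_add M N

lemma sensing_sub (M N : Matrix (Fin n) (Fin n) ℝ) :
    sensing A (M - N) = sensing A M - sensing A N := (sensingLin A).map_sub M N

lemma sensing_smul (c : ℝ) (M : Matrix (Fin n) (Fin n) ℝ) :
    sensing A (c • M) = c • sensing A M := (sensingLin A).map_smul c M

/-- The measurement form `b(M, N) = ⟨𝒜 M, 𝒜 N⟩ / m`, which the restricted isometry property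
compares with the Frobenius inner product. -/
noncomputable def bform (A : Fin m → Matrix (Fin n) (Fin n) ℝ) :
    LinearMap.BilinForm ℝ (Matrix (Fin n) (Fin n) ℝ) :=
  LinearMap.mk₂ ℝ (fun M N => (1 / (m : ℝ)) * inner ℝ (sensing A M) (sensing A N))
    (fun M N K => by rw [sensing_add, inner_add_left]; ring)
    (fun c M N => by rw [sensing_smul, real_inner_smul_left, smul_eq_mul]; ring)
    (fun M N K => by rw [sensing_add, inner_add_right]; ring)
    (fun c M N => by rw [sensing_smul, real_inner_smul_right, smul_eq_mul]; ring)

lemma bform_apply (M N : Matrix (Fin n) (Fin n) ℝ) :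
    bform A M N = (1 / (m : ℝ)) * inner ℝ (sensing A M) (sensing A N) := rfl

lemma bform_comm (M N : Matrix (Fin n) (Fin n) ℝ) : bform A M N = bform A N M := by
  rw [bform_apply, bform_apply, real_inner_comm]

lemma bform_self (M : Matrix (Fin n) (Fin n) ℝ) :
    bform A M M = (1 / (m : ℝ)) * ‖sensing A M‖ ^ 2 := by
  rw [bform_apply, real_inner_self_eq_norm_sq]

lemma bform_self_nonneg (M : Matrix (Fin n) (Fin n) ℝ) : 0 ≤ bform A M M := by
  rw [bform_self]; positivity

lemma bform_le {M N : Matrix (Fin n) (Fin n) ℝ} {a b : ℝ} (ha : 0 ≤ a) (hb : 0 ≤ b)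
    (hM : bform A M M ≤ a ^ 2) (hN : bform A N N ≤ b ^ 2) : bform A M N ≤ a * b := by
  have h := (bform A).apply_sq_le_of_symm bform_self_nonneg ⟨bform_comm⟩ M N
  refine le_of_sq_le_sq (h.trans ?_) (by positivity)
  rw [mul_pow]
  exact mul_le_mul hM hN (bform_self_nonneg N) (by positivity)

lemma damping_nonneg (M : Matrix (Fin n) (Fin n) ℝ) (X : Matrix (Fin n) (Fin r) ℝ) :
    0 ≤ damping A M X := by unfold damping; positivity

lemma damping_sq (M : Matrix (Fin n) (Fin n) ℝ) (X : Matrix (Fin n) (Fin r) ℝ) :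
    damping A M X ^ 2 = bform A (X * Xᵀ - M) (X * Xᵀ - M) := by
  rw [bform_self, damping, mul_pow, div_pow, Real.sq_sqrt (Nat.cast_nonneg m), one_pow]

lemma RIP.lower (h : RIP A s δ) {M : Matrix (Fin n) (Fin n) ℝ} (hM : M.rank ≤ s) :
    (1 - δ) * ‖M‖ ^ 2 ≤ bform A M M := by rw [bform_self]; exact (h M hM).1

lemma RIP.upper (h : RIP A s δ) {M : Matrix (Fin n) (Fin n) ℝ} (hM : M.rank ≤ s) :
    bform A M M ≤ (1 + δ) * ‖M‖ ^ 2 := by rw [bform_self]; exact (h M hM).2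

/-- The restricted isometry property for inner products, by polarization of the two matrices
rescaled to equal norms. -/
lemma RIP.polarization (h : RIP A s δ) {E F : Matrix (Fin n) (Fin n) ℝ}
    (hEF : ∀ a b : ℝ, (a • E + b • F).rank ≤ s) :
    fip E F - δ * (‖E‖ * ‖F‖) ≤ bform A E F := by
  rcases eq_or_ne E 0 with rfl | hE
  · simp
  rcases eq_or_ne F 0 with rfl | hF
  · simp
  have hE' : 0 < ‖E‖ := norm_pos_iff.2 hE
  have hF' : 0 < ‖F‖ := norm_pos_iff.2 hF
  have h1 := h.lower (hEF ‖F‖ ‖E‖)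
  have h2 := h.upper (hEF ‖F‖ (-‖E‖))
  simp only [norm_add_sq, norm_smul_sq] at h1 h2
  simp only [map_add, map_smul, LinearMap.add_apply, LinearMap.smul_apply, smul_eq_mul,
    bform_comm F E] at h1 h2
  have h3 : 4 * (‖E‖ * ‖F‖) * (fip E F - δ * (‖E‖ * ‖F‖)) ≤ 4 * (‖E‖ * ‖F‖) * bform A E F := by
    linarith
  exact le_of_mul_le_mul_left h3 (by positivity)

lemma rank_mul_add_mul_le {p q : ℕ} (X : Matrix (Fin n) (Fin p) ℝ) (U : Matrix (Fin p) (Fin n) ℝ)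
    (Y : Matrix (Fin n) (Fin q) ℝ) (V : Matrix (Fin q) (Fin n) ℝ) :
    (X * U + Y * V).rank ≤ X.rank + Y.rank := by
  have h : LinearMap.range (X * U + Y * V).mulVecLin ≤
      LinearMap.range X.mulVecLin ⊔ LinearMap.range Y.mulVecLin := by
    rintro _ ⟨w, rfl⟩
    refine Submodule.mem_sup.2 ⟨_, ⟨U *ᵥ w, rfl⟩, _, ⟨V *ᵥ w, rfl⟩, ?_⟩
    simp
  exact (Submodule.finrank_mono h).trans (Submodule.finrank_add_le_finrank_add_finrank _ _)

end Measurement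

/-! ### The gradient and the preconditioned inner product -/

section Gradient

variable {n m r : ℕ} {A : Fin m → Matrix (Fin n) (Fin n) ℝ} {δ η : ℝ}

/-- The derivative `X Yᵀ + Y Xᵀ` of `X ↦ X Xᵀ` in the direction `Y`, as a linear map in `Y`. -/
def symProd (X : Matrix (Fin n) (Fin r) ℝ) :
    Matrix (Fin n) (Fin r) ℝ →ₗ[ℝ] Matrix (Fin n) (Fin n) ℝ where
  toFun Y := X * Yᵀ + Y * Xᵀ
  map_add' Y Z := by simp [Matrix.mul_add, Matrix.add_mul]; abel
  map_smul' c Y := by simp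

lemma symProd_apply (X Y : Matrix (Fin n) (Fin r) ℝ) : symProd X Y = X * Yᵀ + Y * Xᵀ := rfl

lemma norm_symProd_le (X Y : Matrix (Fin n) (Fin r) ℝ) : ‖symProd X Y‖ ≤ 2 * ‖Y * Xᵀ‖ := by
  have h : X * Yᵀ = (Y * Xᵀ)ᵀ := by simp
  calc ‖symProd X Y‖ ≤ ‖X * Yᵀ‖ + ‖Y * Xᵀ‖ := norm_add_le _ _
    _ = 2 * ‖Y * Xᵀ‖ := by rw [h, Matrix.frobenius_norm_transpose]; ring

lemma rank_symProd_le (X Y : Matrix (Fin n) (Fin r) ℝ) : (symProd X Y).rank ≤ 2 * r :=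
  (rank_mul_add_mul_le _ _ _ _).trans
    (by have := X.rank_le_width; have := Y.rank_le_width; omega)

/-- A linear functional is represented, for the Frobenius inner product, by the matrix of its
values on the matrix units. -/
lemma fip_of_single (φ : Matrix (Fin n) (Fin r) ℝ →ₗ[ℝ] ℝ) (Y : Matrix (Fin n) (Fin r) ℝ) :
    fip (Matrix.of fun i j => φ (Matrix.single i j 1)) Y = φ Y := by
  conv_rhs => rw [Matrix.matrix_eq_sum_single Y]
  simp only [map_sum, fip_apply, Matrix.of_apply]
  refine Finset.sum_congr rfl fun i _ => Finset.sum_congr rfl fun j _ => ?_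
  rw [show Matrix.single i j (Y i j) = Y i j • Matrix.single i j (1 : ℝ) by simp, map_smul,
    smul_eq_mul, mul_comm]

lemma lineDeriv_loss (y : EuclideanSpace ℝ (Fin m)) (X V : Matrix (Fin n) (Fin r) ℝ) :
    lineDeriv ℝ (loss A y) X V =
      (1 / (m : ℝ)) * (2 * inner ℝ (y - sensing A (X * Xᵀ)) (-sensing A (symProd X V))) := by
  have h : HasDerivAt (fun t : ℝ => (y - sensing A (X * Xᵀ)) - t • sensing A (symProd X V)
      - t ^ 2 • sensing A (V * Vᵀ)) (-sensing A (symProd X V)) 0 := by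
    have h1 : HasDerivAt (fun t : ℝ => t • sensing A (symProd X V))
        ((1 : ℝ) • sensing A (symProd X V)) 0 := (hasDerivAt_id (0 : ℝ)).smul_const _
    have h2 : HasDerivAt (fun t : ℝ => t ^ 2 • sensing A (V * Vᵀ))
        ((((2 : ℕ) : ℝ) * (0 : ℝ) ^ (2 - 1)) • sensing A (V * Vᵀ)) 0 :=
      (hasDerivAt_pow 2 (0 : ℝ)).smul_const _
    convert! (h1.const_sub (y - sensing A (X * Xᵀ))).sub h2 using 1
    simp
  have h' := (h.norm_sq).const_mul (1 / (m : ℝ))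
  have he : (fun t : ℝ => loss A y (X + t • V)) = fun t : ℝ => (1 / (m : ℝ)) *
      ‖(y - sensing A (X * Xᵀ)) - t • sensing A (symProd X V)
        - t ^ 2 • sensing A (V * Vᵀ)‖ ^ 2 := by
    funext t
    have : (X + t • V) * (X + t • V)ᵀ = X * Xᵀ + t • symProd X V + t ^ 2 • (V * Vᵀ) := by
      rw [symProd_apply]
      simp [Matrix.mul_add, Matrix.add_mul, smul_smul, sq]
      abel
    rw [loss, this, sensing_add, sensing_add, sensing_smul, sensing_smul, sub_sub, sub_sub,
      add_assoc]
  rw [lineDeriv, he, h'.deriv]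
  simp

lemma inner_toLp_sensing (e : Fin m → ℝ) (M : Matrix (Fin n) (Fin n) ℝ) :
    inner ℝ (WithLp.toLp 2 e) (sensing A M) = fip (∑ i, e i • A i) M := by
  simp [PiLp.inner_apply, sensing_apply, mul_comm]

/-- The gradient of the loss splits into the gradient of the noiseless loss and a term linear in
the noise. -/
lemma fip_grad_loss (M : Matrix (Fin n) (Fin n) ℝ) (e : Fin m → ℝ)
    (X Y : Matrix (Fin n) (Fin r) ℝ) :
    fip (grad (loss A (sensing A M + WithLp.toLp 2 e)) X) Y =
      2 * bform A (X * Xᵀ - M) (symProd X Y)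
        - 2 / (m : ℝ) * fip (∑ i, e i • A i) (symProd X Y) := by
  have h := fip_of_single ((2 : ℝ) • (bform A (X * Xᵀ - M)).comp (symProd X)
    - (2 / (m : ℝ)) • (fip (∑ i, e i • A i)).comp (symProd X)) Y
  simp only [LinearMap.sub_apply, LinearMap.smul_apply, LinearMap.comp_apply, smul_eq_mul] at h
  rw [← h]
  congr 2
  ext i j
  rw [grad, Matrix.of_apply, Matrix.of_apply, lineDeriv_loss, ← inner_toLp_sensing, bform_apply,
    sensing_sub, inner_neg_right, inner_sub_left, inner_sub_left, inner_add_left]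
  ring

/-- The preconditioned inner product `⟨U (XᵀX + η I), V⟩`, written as a sum of two positive
semidefinite terms. -/
def pip (X : Matrix (Fin n) (Fin r) ℝ) (η : ℝ) :
    LinearMap.BilinForm ℝ (Matrix (Fin n) (Fin r) ℝ) :=
  LinearMap.mk₂ ℝ (fun U V => fip (U * Xᵀ) (V * Xᵀ) + η * fip U V)
    (fun U V W => by simp [Matrix.add_mul]; ring)
    (fun c U V => by simp; ring)
    (fun U V W => by simp [Matrix.add_mul]; ring)
    (fun c U V => by simp; ring)

lemma pip_apply (X U V : Matrix (Fin n) (Fin r) ℝ) :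
    pip X η U V = fip (U * Xᵀ) (V * Xᵀ) + η * fip U V := rfl

lemma pip_self (X U : Matrix (Fin n) (Fin r) ℝ) :
    pip X η U U = ‖U * Xᵀ‖ ^ 2 + η * ‖U‖ ^ 2 := by
  rw [pip_apply, fip_self, fip_self]

lemma pip_comm (X U V : Matrix (Fin n) (Fin r) ℝ) : pip X η U V = pip X η V U := by
  rw [pip_apply, pip_apply, fip_comm, fip_comm U]

lemma pip_self_nonneg (hη : 0 ≤ η) (X U : Matrix (Fin n) (Fin r) ℝ) : 0 ≤ pip X η U U := by
  rw [pip_self]; positivity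

lemma pip_sq_le (hη : 0 ≤ η) (X U V : Matrix (Fin n) (Fin r) ℝ) :
    pip X η U V ^ 2 ≤ pip X η U U * pip X η V V :=
  (pip X η).apply_sq_le_of_symm (pip_self_nonneg hη X) ⟨pip_comm X⟩ U V

/-- The direction `G (XᵀX + η I)⁻¹` represents the functional `⟨G, ·⟩` for the preconditioned
inner product. -/
lemma pip_mul_inv (hη : 0 < η) (X G Y : Matrix (Fin n) (Fin r) ℝ) :
    pip X η (G * (Xᵀ * X + η • (1 : Matrix (Fin r) (Fin r) ℝ))⁻¹) Y = fip G Y := by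
  set R := Xᵀ * X + η • (1 : Matrix (Fin r) (Fin r) ℝ) with hR
  have hpd : R.PosDef := by
    have h1 : (Xᵀ * X).PosSemidef := by
      simpa using Matrix.posSemidef_conjTranspose_mul_self X
    exact Matrix.PosDef.posSemidef_add h1 (Matrix.PosDef.one.smul hη)
  have hdet : IsUnit R.det := (Matrix.isUnit_iff_isUnit_det _).1 hpd.isUnit
  have h2 : ∀ D : Matrix (Fin n) (Fin r) ℝ, pip X η D Y = fip (D * R) Y := by
    intro D
    rw [hR, Matrix.mul_add, map_add, LinearMap.add_apply, ← Matrix.mul_assoc,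
      fip_mul_right (D * Xᵀ), pip_apply]
    simp
  rw [h2, Matrix.mul_assoc, Matrix.nonsing_inv_mul _ hdet, Matrix.mul_one]

/-- Linear functionals are represented by the preconditioned inner product. -/
lemma exists_pip_eq (hη : 0 < η) (X : Matrix (Fin n) (Fin r) ℝ)
    (φ : Matrix (Fin n) (Fin r) ℝ →ₗ[ℝ] ℝ) : ∃ D, ∀ Y, pip X η D Y = φ Y :=
  ⟨_, fun Y => (pip_mul_inv hη X _ Y).trans (fip_of_single φ Y)⟩

end Gradient

/-! ### Descent along a perturbed preconditioned gradient -/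

section Descent

variable {n m r : ℕ} {A : Fin m → Matrix (Fin n) (Fin n) ℝ} {δ η α μ : ℝ}

lemma bform_symProd_le (hδ : δ < 1) (hη : 0 ≤ η) (hA : RIP A (2 * r) δ)
    (X Y : Matrix (Fin n) (Fin r) ℝ) :
    bform A (symProd X Y) (symProd X Y) ≤ (3 * √(pip X η Y Y)) ^ 2 := by
  rw [mul_pow, Real.sq_sqrt (pip_self_nonneg hη X Y), pip_self]
  have h1 := hA.upper (rank_symProd_le X Y)
  have h2 := pow_le_pow_left₀ (norm_nonneg _) (norm_symProd_le X Y) 2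
  have h3 : 0 ≤ η * ‖Y‖ ^ 2 := by positivity
  nlinarith [sq_nonneg ‖symProd X Y‖, sq_nonneg ‖Y * Xᵀ‖]

/-- The squared preconditioned norm of the noiseless gradient is at most `36` times the loss. -/
lemma pip_le_of_forall_pip_eq (hδ : δ < 1) (hη : 0 ≤ η) (hA : RIP A (2 * r) δ)
    {X D : Matrix (Fin n) (Fin r) ℝ} {E : Matrix (Fin n) (Fin n) ℝ} (hE : bform A E E ≤ η ^ 2)
    (hD : ∀ Y, pip X η D Y = 2 * bform A E (symProd X Y)) : pip X η D D ≤ 36 * η ^ 2 := by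
  have h0 := pip_self_nonneg hη X D
  have h1 := bform_le hη (by positivity) hE (bform_symProd_le hδ hη hA X D)
  have h2 : √(pip X η D D) ^ 2 ≤ 6 * η * √(pip X η D D) := by
    rw [Real.sq_sqrt h0, hD D]; rw [hD D] at h1; linarith
  have h3 : √(pip X η D D) ≤ 6 * η := by
    rcases (Real.sqrt_nonneg (pip X η D D)).eq_or_lt with h | h
    · rw [← h]; positivity
    · rw [sq] at h2; exact le_of_mul_le_mul_right h2 h
  calc pip X η D D = √(pip X η D D) ^ 2 := (Real.sq_sqrt h0).symm
    _ ≤ (6 * η) ^ 2 := pow_le_pow_left₀ (Real.sqrt_nonneg _) h3 2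
    _ = 36 * η ^ 2 := by ring

/-- The terms of order `α²` and higher are absorbed by the first-order decrease `α (p + z)`. -/
lemma descent_scalar {a p q z x f y h : ℝ} (hα : 0 < α) (hα1 : α ≤ 1 / 4000) (hμ0 : 0 ≤ μ)
    (hx : x ≤ 3 / 2 * a ^ 2) (hf : f ≤ (3 * a) ^ 2) (hy : -y ≤ 3 * a * (27 / 2 * a))
    (hh : h ≤ (27 / 2 * a) ^ 2) (hh0 : 0 ≤ h) (ha2 : a ^ 2 = p + 2 * z + q)
    (hz2 : 2 * z ≤ p + q) (hp : 2 * μ * η ^ 2 ≤ p)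
    (hq : q ≤ μ * η ^ 2 / 4) :
    η ^ 2 - α * (p + z) + α ^ 2 * (2 * x + f + α * (2 * -y) + α ^ 2 * h) ≤
      (1 - α * μ / 2) * η ^ 2 := by
  have h1 : α * (2 * -y) ≤ 81 * a ^ 2 := by
    calc α * (2 * -y) ≤ α * (81 * a ^ 2) := mul_le_mul_of_nonneg_left (by linarith) hα.le
      _ ≤ 1 * (81 * a ^ 2) := mul_le_mul_of_nonneg_right (by linarith) (by positivity)
      _ = 81 * a ^ 2 := one_mul _
  have h2 : α ^ 2 * h ≤ 1 * (27 / 2 * a) ^ 2 := mul_le_mul (by nlinarith) hh hh0 (by norm_num)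
  have hrem : 2 * x + f + α * (2 * -y) + α ^ 2 * h ≤ 300 * a ^ 2 := by
    linarith [sq_nonneg a]
  have h3 : α * (300 * a ^ 2) ≤ 1 / 4000 * (300 * a ^ 2) :=
    mul_le_mul_of_nonneg_right hα1 (by positivity)
  have h4 : α ^ 2 * (2 * x + f + α * (2 * -y) + α ^ 2 * h) ≤ α * (3 / 20 * (p + q)) := by
    calc α ^ 2 * (2 * x + f + α * (2 * -y) + α ^ 2 * h) ≤ α ^ 2 * (300 * a ^ 2) :=
          mul_le_mul_of_nonneg_left hrem (by positivity)
      _ = α * (α * (300 * a ^ 2)) := by ring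
      _ ≤ α * (3 / 20 * (p + q)) := mul_le_mul_of_nonneg_left (by linarith) hα.le
  have h5 : α * (3 / 20 * (p + q)) ≤ α * (p + z - μ / 2 * η ^ 2) := by
    refine mul_le_mul_of_nonneg_left ?_ hα.le
    have : 0 ≤ μ * η ^ 2 := by positivity
    linarith
  linarith

/-- One step in the direction `D₁ + D₂`, where `D₁` is the preconditioned gradient of the noiseless
loss and `D₂` is a perturbation that is small compared with the loss, decreases the noiseless loss
by the factor `1 - α μ / 2`. -/
lemma bform_step_le (hδ : δ < 1) (hη : 0 < η) (hA : RIP A (2 * r) δ)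
    {X D₁ D₂ : Matrix (Fin n) (Fin r) ℝ} {M : Matrix (Fin n) (Fin n) ℝ}
    (hE : bform A (X * Xᵀ - M) (X * Xᵀ - M) = η ^ 2)
    (hD₁ : ∀ Y, pip X η D₁ Y = 2 * bform A (X * Xᵀ - M) (symProd X Y))
    (hμ0 : 0 ≤ μ) (hμ1 : μ ≤ 1) (hPL : 2 * μ * η ^ 2 ≤ pip X η D₁ D₁)
    (hD₂ : pip X η D₂ D₂ ≤ μ * η ^ 2 / 4) (hα : 0 < α) (hα1 : α ≤ 1 / 4000) :
    bform A ((X - α • (D₁ + D₂)) * (X - α • (D₁ + D₂))ᵀ - M)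
      ((X - α • (D₁ + D₂)) * (X - α • (D₁ + D₂))ᵀ - M) ≤ (1 - α * μ / 2) * η ^ 2 := by
  set E := X * Xᵀ - M with hEdef
  set D := D₁ + D₂ with hDdef
  set F := symProd X D with hF
  set H := D * Dᵀ with hH
  have hp := pip_le_of_forall_pip_eq hδ hη.le hA hE.le hD₁
  set p := pip X η D₁ D₁ with hpdef
  set q := pip X η D₂ D₂ with hqdef
  set z := pip X η D₁ D₂ with hzdef
  have hq0 : 0 ≤ q := pip_self_nonneg hη.le X D₂
  have hz2 : 2 * z ≤ p + q := by
    have := pip_self_nonneg hη.le X (D₁ - D₂)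
    simp only [map_sub, LinearMap.sub_apply, pip_comm X D₂ D₁] at this
    linarith
  have hD : pip X η D D = p + 2 * z + q := by
    simp only [hDdef, map_add, LinearMap.add_apply, pip_comm X D₂ D₁]
    linarith
  have hη2 : 0 < η ^ 2 := by positivity
  have hμη : μ * η ^ 2 ≤ η ^ 2 := by nlinarith
  set a := √(pip X η D D) with ha
  have ha0 : 0 ≤ a := Real.sqrt_nonneg _
  have ha2 : a ^ 2 = p + 2 * z + q := by rw [ha, Real.sq_sqrt (pip_self_nonneg hη.le X D), hD]
  have ha9 : a ≤ 9 * η := by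
    refine le_of_sq_le_sq ?_ (by positivity)
    rw [ha2]; nlinarith
  have hEF : 2 * bform A E F = p + z := by
    rw [← hD₁ D, hDdef, map_add]
  have hFF : bform A F F ≤ (3 * a) ^ 2 := bform_symProd_le hδ hη.le hA X D
  -- `‖D Dᵀ‖ ≤ ‖D‖² ≤ a² / η`, because `η ‖D‖²` is part of the preconditioned norm
  have hHn : ‖H‖ ≤ a ^ 2 / η := by
    rw [le_div_iff₀ hη]
    have h1 := norm_mul_transpose_le D
    have h2 : η * ‖D‖ ^ 2 ≤ a ^ 2 := by
      rw [ha2, ← hD, pip_self]; nlinarith [sq_nonneg ‖D * Xᵀ‖]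
    calc ‖H‖ * η ≤ ‖D‖ ^ 2 * η := mul_le_mul_of_nonneg_right h1 hη.le
      _ ≤ a ^ 2 := by linarith
  have hHH : bform A H H ≤ (3 / 2 * (a ^ 2 / η)) ^ 2 := by
    have h1 := hA.upper (M := H) ((Matrix.rank_mul_le_left _ _).trans
      (by have := D.rank_le_width; omega))
    have h2 := pow_le_pow_left₀ (norm_nonneg _) hHn 2
    nlinarith [sq_nonneg ‖H‖]
  have hah : a ^ 2 / η ≤ 9 * a := by
    rw [div_le_iff₀ hη]; nlinarith
  have hah0 : 0 ≤ a ^ 2 / η := by positivity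
  have hHH' : bform A H H ≤ (27 / 2 * a) ^ 2 :=
    hHH.trans (pow_le_pow_left₀ (by positivity) (by linarith) 2)
  have hEH : bform A E H ≤ 3 / 2 * a ^ 2 := by
    have h := bform_le hη.le (by positivity) hE.le hHH
    calc bform A E H ≤ η * (3 / 2 * (a ^ 2 / η)) := h
      _ = 3 / 2 * a ^ 2 := by field_simp
  have hFH : -bform A F H ≤ 3 * a * (27 / 2 * a) := by
    have h := bform_le (M := -F) (N := H) (a := 3 * a) (b := 27 / 2 * a)
      (by positivity) (by positivity)
      (by simpa using hFF) hHH'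
    simpa using h
  have hexp : (X - α • D) * (X - α • D)ᵀ - M = E - α • F + α ^ 2 • H := by
    rw [hF, symProd_apply, hH, hEdef]
    simp [Matrix.mul_sub, Matrix.sub_mul, smul_sub, smul_smul, sq]
    abel
  have hval : bform A (E - α • F + α ^ 2 • H) (E - α • F + α ^ 2 • H) =
      η ^ 2 - α * (2 * bform A E F) + α ^ 2 * (2 * bform A E H + bform A F F
        + α * (2 * -bform A F H) + α ^ 2 * bform A H H) := by
    simp only [map_add, map_sub, map_smul, LinearMap.add_apply, LinearMap.sub_apply,
      LinearMap.smul_apply, smul_eq_mul, hE, bform_comm F E, bform_comm H E, bform_comm H F]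
    ring
  rw [hexp, hval, hEF]
  exact descent_scalar hα hα1 hμ0 hEH hFF hFH hHH' (bform_self_nonneg H) ha2 hz2 hPL hD₂

end Descent

/-! ### The spectrum of the ground truth -/

section Spectrum

variable {n : ℕ} {M : Matrix (Fin n) (Fin n) ℝ}

/-- A symmetric matrix is orthogonally diagonalizable. -/
lemma exists_orthogonal_diagonalization (hM : M.IsHermitian) :
    ∃ U : Matrix (Fin n) (Fin n) ℝ, Uᵀ * U = 1 ∧ U * Uᵀ = 1 ∧
      M = U * Matrix.diagonal hM.eigenvalues * Uᵀ := by
  refine ⟨hM.eigenvectorUnitary, ?_, ?_, ?_⟩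
  · have := Unitary.coe_star_mul_self hM.eigenvectorUnitary
    simpa [Matrix.star_eq_conjTranspose] using this
  · have := Unitary.coe_mul_star_self hM.eigenvectorUnitary
    simpa [Matrix.star_eq_conjTranspose] using this
  · have := hM.spectral_theorem
    rw [Unitary.conjStarAlgAut_apply] at this
    simpa [Matrix.star_eq_conjTranspose, Function.comp_def] using this

lemma exists_transpose_mul_self_eq (hM : M.PosSemidef) :
    ∃ Z : Matrix (Fin n) (Fin n) ℝ, M = Zᵀ * Z := by
  obtain ⟨U, -, -, hU⟩ := exists_orthogonal_diagonalization hM.1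
  refine ⟨Matrix.diagonal (fun i => √(hM.1.eigenvalues i)) * Uᵀ, ?_⟩
  conv_lhs => rw [hU]
  rw [Matrix.transpose_mul, Matrix.transpose_transpose, Matrix.diagonal_transpose,
    Matrix.mul_assoc, Matrix.mul_assoc, ← Matrix.mul_assoc (Matrix.diagonal _) (Matrix.diagonal _),
    Matrix.diagonal_mul_diagonal]
  simp only [Real.mul_self_sqrt (hM.eigenvalues_nonneg _)]

/-- A positive semidefinite matrix of rank `k` has exactly `k` nonzero eigenvalues, so that each
eigenvalue is zero or at least the `k`-th largest one. -/
lemma eigenvalues_eq_zero_or_eigval_rank_le (hM : M.PosSemidef) {k : ℕ} (hk : 0 < k)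
    (hr : M.rank = k) (i : Fin n) :
    hM.1.eigenvalues i = 0 ∨ eigval M k ≤ hM.1.eigenvalues i := by
  have hkn : k ≤ n := hr ▸ M.rank_le_width
  rw [eigval, dif_pos ⟨hM.1, hk, hkn⟩]
  by_contra! hcon
  obtain ⟨hne, hlt⟩ := hcon
  set e := (Fintype.equivOfCardEq (Fintype.card_fin (Fintype.card (Fin n)))).symm with he
  have hpos : 0 < hM.1.eigenvalues i := lt_of_le_of_ne (hM.eigenvalues_nonneg i) hne.symm
  have hi : hM.1.eigenvalues i = hM.1.eigenvalues₀ (e i) := rfl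
  -- all eigenvalues listed up to the position of the `i`-th one are positive
  have hall : ∀ j : Fin (Fintype.card (Fin n)), j ≤ e i → hM.1.eigenvalues (e.symm j) ≠ 0 := by
    intro j hj
    have h1 : hM.1.eigenvalues (e.symm j) = hM.1.eigenvalues₀ j := by
      change hM.1.eigenvalues₀ (e (e.symm j)) = _
      rw [Equiv.apply_symm_apply]
    rw [h1]
    exact (hpos.trans_le (hi ▸ hM.1.eigenvalues₀_antitone hj)).ne'
  have hki : k ≤ (e i : ℕ) := by
    by_contra! h
    have : e i ≤ ⟨k - 1, by rw [Fintype.card_fin]; omega⟩ := by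
      rw [Fin.le_def]; simp only; omega
    exact absurd (hM.1.eigenvalues₀_antitone this) (not_le.2 (hi ▸ hlt))
  have hcard : Fintype.card {i // hM.1.eigenvalues i ≠ 0} = k := by
    rw [← hM.1.rank_eq_card_non_zero_eigs, hr]
  have hinj : Function.Injective fun j : Fin (k + 1) =>
      (⟨e.symm ⟨j, by have := (e i).2; omega⟩, hall _ (by rw [Fin.le_def]; simp only; omega)⟩ :
        {i // hM.1.eigenvalues i ≠ 0}) := by
    intro j j' h
    simpa [Fin.ext_iff] using h
  have := Fintype.card_le_of_injective _ hinj
  rw [hcard, Fintype.card_fin] at this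
  omega

lemma eigval_nonneg (hM : M.PosSemidef) (k : ℕ) : 0 ≤ eigval M k := by
  unfold eigval
  split_ifs with h
  · have := hM.eigenvalues_nonneg ((Fintype.equivOfCardEq
      (Fintype.card_fin (Fintype.card (Fin n)))) ⟨k - 1, by rw [Fintype.card_fin]; omega⟩)
    simpa [Matrix.IsHermitian.eigenvalues] using this
  · exact le_rfl

/-- Every nonzero eigenvalue of the positive semidefinite matrix `M` is at least `l`, expressed as
`M² ≥ l M` and `M³ ≥ l M²` for the associated quadratic forms. -/
structure SpectralGap (M : Matrix (Fin n) (Fin n) ℝ) (l : ℝ) : Prop where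
  sq_le : ∀ v : Fin n → ℝ, l * (v ⬝ᵥ M *ᵥ v) ≤ (M *ᵥ v) ⬝ᵥ (M *ᵥ v)
  cube_le : ∀ v : Fin n → ℝ, l * ((M *ᵥ v) ⬝ᵥ (M *ᵥ v)) ≤ (M *ᵥ v) ⬝ᵥ M *ᵥ (M *ᵥ v)

lemma spectralGap_eigval (hM : M.PosSemidef) {k : ℕ} (hk : 0 < k) (hr : M.rank = k) :
    SpectralGap M (eigval M k) := by
  obtain ⟨U, hU, -, hMU⟩ := exists_orthogonal_diagonalization hM.1
  set μ := hM.1.eigenvalues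
  have hμ : ∀ i, 0 ≤ μ i * (μ i - eigval M k) := fun i => by
    rcases eigenvalues_eq_zero_or_eigval_rank_le hM hk hr i with h | h
    · change 0 ≤ hM.1.eigenvalues i * _
      rw [h]; simp
    · exact mul_nonneg (hM.eigenvalues_nonneg i) (sub_nonneg.2 h)
  have hμ0 : ∀ i, 0 ≤ μ i := hM.eigenvalues_nonneg
  have hMv : ∀ v, M *ᵥ v = U *ᵥ (fun i => μ i * (Uᵀ *ᵥ v) i) := fun v => by
    conv_lhs => rw [hMU, ← Matrix.mulVec_mulVec, ← Matrix.mulVec_mulVec]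
    congr 1
    ext i
    rw [Matrix.mulVec_diagonal]
  have hdot : ∀ v w, v ⬝ᵥ U *ᵥ w = (Uᵀ *ᵥ v) ⬝ᵥ w := fun v w => by
    rw [Matrix.dotProduct_mulVec, Matrix.mulVec_transpose]
  have hUU : ∀ w, Uᵀ *ᵥ (U *ᵥ w) = w := fun w => by
    rw [Matrix.mulVec_mulVec, hU, Matrix.one_mulVec]
  constructor <;> intro v
  · rw [hMv, hdot, hdot, hUU]
    simp only [dotProduct, Finset.mul_sum]
    refine Finset.sum_le_sum fun i _ => ?_
    nlinarith [mul_nonneg (hμ i) (sq_nonneg ((Uᵀ *ᵥ v) i))]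
  · rw [hMv (M *ᵥ v), hMv, hdot, hdot, hUU]
    simp only [dotProduct, Finset.mul_sum]
    refine Finset.sum_le_sum fun i _ => ?_
    nlinarith [mul_nonneg (mul_nonneg (hμ i) (hμ0 i)) (sq_nonneg ((Uᵀ *ᵥ v) i))]

end Spectrum

/-! ### Block decomposition along an orthogonal projection -/

section Projection

variable {n : ℕ} {P E M : Matrix (Fin n) (Fin n) ℝ}

lemma fip_proj_left (hPt : Pᵀ = P) (hP : P * P = P) (A B : Matrix (Fin n) (Fin n) ℝ) :
    fip (P * A) ((1 - P) * B) = 0 := by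
  rw [fip_mul_left, hPt, ← Matrix.mul_assoc, show P * (1 - P) = 0 by rw [mul_sub, hP]; simp]
  simp

lemma fip_proj_right (hPt : Pᵀ = P) (hP : P * P = P) (A B : Matrix (Fin n) (Fin n) ℝ) :
    fip (A * P) (B * (1 - P)) = 0 := by
  rw [fip_mul_right, hPt, Matrix.mul_assoc, show (1 - P) * P = 0 by rw [sub_mul, hP]; simp]
  simp

lemma norm_sq_eq_proj_left (hPt : Pᵀ = P) (hP : P * P = P) (A : Matrix (Fin n) (Fin n) ℝ) :
    ‖A‖ ^ 2 = ‖P * A‖ ^ 2 + ‖(1 - P) * A‖ ^ 2 := by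
  have h := norm_add_sq (P * A) ((1 - P) * A)
  rw [fip_proj_left hPt hP, show P * A + (1 - P) * A = A by noncomm_ring] at h
  linarith

lemma fip_compl_block (hPt : Pᵀ = P) (hP : P * P = P) (E : Matrix (Fin n) (Fin n) ℝ) :
    fip E ((1 - P) * E * (1 - P)) = ‖(1 - P) * E * (1 - P)‖ ^ 2 := by
  have hQt : (1 - P)ᵀ = 1 - P := by rw [Matrix.transpose_sub, hPt, Matrix.transpose_one]
  have hQ : (1 - P) * (1 - P) = 1 - P := IsIdempotentElem.one_sub hP
  rw [← fip_self, fip_mul_right, fip_mul_left, hQt]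
  congr 1
  calc (1 - P) * E * (1 - P) = ((1 - P) * (1 - P)) * E * ((1 - P) * (1 - P)) := by rw [hQ]
    _ = (1 - P) * ((1 - P) * E * (1 - P) * (1 - P)) := by simp only [Matrix.mul_assoc]

lemma fip_sub_compl_block (hPt : Pᵀ = P) (hP : P * P = P) (E : Matrix (Fin n) (Fin n) ℝ) :
    fip E (E - (1 - P) * E * (1 - P)) = ‖E‖ ^ 2 - ‖(1 - P) * E * (1 - P)‖ ^ 2 := by
  rw [map_sub, fip_compl_block hPt hP, fip_self]

lemma norm_sub_compl_block_sq (hPt : Pᵀ = P) (hP : P * P = P) (E : Matrix (Fin n) (Fin n) ℝ) :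
    ‖E - (1 - P) * E * (1 - P)‖ ^ 2 = ‖E‖ ^ 2 - ‖(1 - P) * E * (1 - P)‖ ^ 2 := by
  rw [norm_sub_sq, fip_compl_block hPt hP]; ring

lemma norm_compl_block_transpose (hPt : Pᵀ = P) (hE : Eᵀ = E) :
    ‖(1 - P) * E * P‖ = ‖P * E * (1 - P)‖ := by
  have : (P * E * (1 - P))ᵀ = (1 - P) * E * P := by
    rw [Matrix.transpose_mul, Matrix.transpose_mul, hE, hPt, Matrix.transpose_sub, hPt,
      Matrix.transpose_one, Matrix.mul_assoc]
  rw [← this, Matrix.frobenius_norm_transpose]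

/-- The squared norm of a symmetric matrix without its `(1 - P, 1 - P)` block. -/
lemma norm_sub_compl_block_sq_eq (hPt : Pᵀ = P) (hP : P * P = P) (hE : Eᵀ = E) :
    ‖E - (1 - P) * E * (1 - P)‖ ^ 2 = ‖P * E * P‖ ^ 2 + 2 * ‖P * E * (1 - P)‖ ^ 2 := by
  have h1 : E - (1 - P) * E * (1 - P) = (P * E * P + P * E * (1 - P)) + (1 - P) * E * P := by
    noncomm_ring
  have h2 : fip (P * E * P + P * E * (1 - P)) ((1 - P) * E * P) = 0 := by
    rw [← mul_add, Matrix.mul_assoc, Matrix.mul_assoc, fip_proj_left hPt hP]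
  rw [h1, norm_add_sq, h2, norm_add_sq, fip_proj_right hPt hP, norm_compl_block_transpose hPt hE]
  ring

lemma two_mul_norm_half_block_sq_le (hPt : Pᵀ = P) (hP : P * P = P) (hE : Eᵀ = E) :
    2 * ‖E * P - (1 / 2 : ℝ) • (P * E * P)‖ ^ 2 ≤ ‖E - (1 - P) * E * (1 - P)‖ ^ 2 := by
  have h1 : E * P - (1 / 2 : ℝ) • (P * E * P) = (1 / 2 : ℝ) • (P * E * P) + (1 - P) * E * P := by
    rw [sub_mul, sub_mul, one_mul]; module
  rw [h1, norm_add_sq, norm_smul_sq, map_smul, LinearMap.smul_apply, Matrix.mul_assoc,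
    Matrix.mul_assoc, fip_proj_left hPt hP, norm_sub_compl_block_sq_eq hPt hP hE,
    ← norm_compl_block_transpose hPt hE, smul_zero, ← Matrix.mul_assoc, ← Matrix.mul_assoc]
  nlinarith [sq_nonneg ‖P * E * P‖]

/-- If the nonzero eigenvalues of `M` are at least `l`, the off-diagonal block of `M` controls the
diagonal block: `‖P M Q‖² = tr (Q M² Q) - ‖Q M Q‖² ≥ l tr (Q M Q) - ‖Q M Q‖²`. -/
lemma SpectralGap.block_le {l : ℝ} (hM : M.PosSemidef) (hgap : SpectralGap M l) (hl : 0 ≤ l)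
    (hPt : Pᵀ = P) (hP : P * P = P) :
    (l - ‖(1 - P) * M * (1 - P)‖) * ‖(1 - P) * M * (1 - P)‖ ≤ ‖P * M * (1 - P)‖ ^ 2 := by
  set Q := 1 - P with hQdef
  have hQt : Qᵀ = Q := by rw [hQdef, Matrix.transpose_sub, hPt, Matrix.transpose_one]
  have h1 := norm_sq_eq_proj_left hPt hP (M * Q)
  have h2 : l * fip Q (M * Q) ≤ ‖M * Q‖ ^ 2 := by
    have hcol : ∀ j i, (M * Q) i j = (M *ᵥ fun a => Q a j) i := fun j i => by
      simp [Matrix.mul_apply, Matrix.mulVec, dotProduct]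
    rw [← fip_self, ← fip_transpose, ← fip_transpose (M * Q), fip_apply, fip_apply, Finset.mul_sum]
    refine Finset.sum_le_sum fun j _ => ?_
    have := hgap.sq_le fun a => Q a j
    simpa only [dotProduct, Matrix.transpose_apply, ← hcol] using this
  have h3 : ‖Q * M * Q‖ ≤ fip Q (M * Q) := by
    obtain ⟨Z, hZ⟩ := exists_transpose_mul_self_eq hM
    have h4 : Q * M * Q = (Z * Q)ᵀ * (Z * Q)ᵀᵀ := by
      rw [hZ, Matrix.transpose_transpose, Matrix.transpose_mul, hQt]
      simp only [Matrix.mul_assoc]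
    have h5 : fip Q (M * Q) = ‖(Z * Q)ᵀ‖ ^ 2 := by
      rw [Matrix.frobenius_norm_transpose, ← fip_self, fip_mul_left, hZ, Matrix.mul_assoc]
    rw [h4, h5]
    exact norm_mul_transpose_le _
  rw [← hQdef, ← Matrix.mul_assoc, ← Matrix.mul_assoc] at h1
  nlinarith [mul_le_mul_of_nonneg_left h3 hl]

end Projection

/-! ### The large eigenvalues of `X Xᵀ` -/

section Factor

variable {n r k : ℕ} {X : Matrix (Fin n) (Fin r) ℝ} {M : Matrix (Fin n) (Fin n) ℝ}
  {s : Fin r → ℝ} {l t : ℝ}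

lemma gram_eigenvalue_nonneg (hs : Xᵀ * X = Matrix.diagonal s) (j : Fin r) : 0 ≤ s j := by
  have h : (Xᵀ * X) j j = s j := by rw [hs]; simp
  rw [← h, Matrix.mul_apply]
  exact Finset.sum_nonneg fun i _ => by rw [Matrix.transpose_apply]; exact mul_self_nonneg _

lemma dotProduct_mulVec_le (E : Matrix (Fin n) (Fin n) ℝ) (z : Fin n → ℝ) :
    -(z ⬝ᵥ E *ᵥ z) ≤ ‖E‖ * (z ⬝ᵥ z) := by
  have h := fip_le (-E) (Matrix.vecMulVec z z)
  have h0 : 0 ≤ z ⬝ᵥ z := by simpa using dotProduct_star_self_nonneg z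
  have h1 : ‖Matrix.vecMulVec z z‖ = z ⬝ᵥ z :=
    (sq_eq_sq₀ (norm_nonneg _) h0).1 (by rw [norm_vecMulVec_sq, sq])
  rwa [fip_vecMulVec, norm_neg, h1, Matrix.neg_mulVec, dotProduct_neg] at h

/-- By a dimension count, `X Xᵀ` has at least `rank M` eigenvalues `≥ t` as soon as the error
`‖X Xᵀ - M‖` is smaller than `l - t`: otherwise a vector of the range of `M` would be orthogonal to
the corresponding columns of `X`. -/
lemma rank_le_card_large (hs : Xᵀ * X = Matrix.diagonal s) (hgap : SpectralGap M l)
    (ht : 0 ≤ t) (hrank : M.rank = k) (hlt : t + ‖X * Xᵀ - M‖ < l) :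
    k ≤ (Finset.univ.filter fun j => t ≤ s j).card := by
  by_contra! hcard
  let f : LinearMap.range M.mulVecLin →ₗ[ℝ] ({j // t ≤ s j} → ℝ) :=
    (LinearMap.funLeft ℝ ℝ Subtype.val ∘ₗ Xᵀ.mulVecLin) ∘ₗ (LinearMap.range M.mulVecLin).subtype
  have hker : LinearMap.ker f ≠ ⊥ := by
    refine f.ker_ne_bot_of_finrank_lt ?_
    rw [Module.finrank_fintype_fun_eq_card, Fintype.card_subtype]
    exact hcard.trans_eq hrank.symm
  obtain ⟨⟨z, hz⟩, hzk, hz0⟩ := Submodule.exists_mem_ne_zero_of_ne_bot hker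
  have hz0' : z ≠ 0 := fun h => hz0 (by ext1; exact h)
  obtain ⟨w, hw⟩ := hz
  have hw' : M *ᵥ w = z := hw
  set v := Xᵀ *ᵥ z with hv
  have hv0 : ∀ j, t ≤ s j → v j = 0 := fun j hj => congr_fun (LinearMap.mem_ker.1 hzk) ⟨j, hj⟩
  have hzz : 0 < z ⬝ᵥ z := by
    have := Matrix.dotProduct_star_self_pos_iff.2 hz0'
    simpa using this
  have h1 : l * (z ⬝ᵥ z) ≤ z ⬝ᵥ M *ᵥ z := by rw [← hw']; exact hgap.cube_le w
  have h2 := dotProduct_mulVec_le (X * Xᵀ - M) z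
  have h3 : z ⬝ᵥ (X * Xᵀ) *ᵥ z = v ⬝ᵥ v := by
    rw [← Matrix.mulVec_mulVec, Matrix.dotProduct_mulVec, ← Matrix.mulVec_transpose]
  rw [Matrix.sub_mulVec, dotProduct_sub, h3] at h2
  -- Bessel's inequality: `‖v‖⁴ = ⟨z, X v⟩² ≤ ‖z‖² ⟨v, XᵀX v⟩ ≤ t ‖z‖² ‖v‖²`
  have h4 : v ⬝ᵥ v ≤ t * (z ⬝ᵥ z) := by
    have hvv : 0 ≤ v ⬝ᵥ v := by simpa using dotProduct_star_self_nonneg v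
    have e1 : z ⬝ᵥ X *ᵥ v = v ⬝ᵥ v := by
      rw [Matrix.dotProduct_mulVec, ← Matrix.mulVec_transpose]
    have e2 : (X *ᵥ v) ⬝ᵥ (X *ᵥ v) = ∑ j, s j * v j ^ 2 := by
      rw [Matrix.dotProduct_mulVec, ← Matrix.mulVec_transpose, Matrix.mulVec_mulVec, hs]
      simp only [dotProduct, Matrix.mulVec_diagonal]
      exact Finset.sum_congr rfl fun j _ => by ring
    have e3 : ∑ j, s j * v j ^ 2 ≤ t * (v ⬝ᵥ v) := by
      rw [dotProduct, Finset.mul_sum]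
      refine Finset.sum_le_sum fun j _ => ?_
      by_cases hj : t ≤ s j
      · simp [hv0 j hj]
      · nlinarith [sq_nonneg (v j), not_le.1 hj]
    have e4 : (z ⬝ᵥ X *ᵥ v) ^ 2 ≤ (z ⬝ᵥ z) * ((X *ᵥ v) ⬝ᵥ (X *ᵥ v)) := by
      have := Finset.sum_mul_sq_le_sq_mul_sq Finset.univ z (X *ᵥ v)
      simpa only [dotProduct, sq] using this
    rw [e1, e2] at e4
    rcases hvv.eq_or_lt with h | h
    · rw [← h]; positivity
    · have : (v ⬝ᵥ v) * (v ⬝ᵥ v) ≤ (t * (z ⬝ᵥ z)) * (v ⬝ᵥ v) := by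
        nlinarith [mul_le_mul_of_nonneg_left e3 hzz.le]
      exact le_of_mul_le_mul_right this h
  have : l * (z ⬝ᵥ z) ≤ (t + ‖X * Xᵀ - M‖) * (z ⬝ᵥ z) := by linarith
  exact absurd (le_of_mul_le_mul_right this hzz) (not_le.2 hlt)

end Factor

/-! ### Gradient dominance -/

section Dominance

variable {n m r k : ℕ} {X : Matrix (Fin n) (Fin r) ℝ} {M : Matrix (Fin n) (Fin n) ℝ}
  {s : Fin r → ℝ} {l t δ ρ : ℝ}

lemma sq_le_third_of_basin (hρ : 0 < ρ) (hρ1 : ρ < 1)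
    (hρδ : ρ ^ 2 / (1 - ρ ^ 2) ≤ (1 - δ ^ 2) / 2) : ρ ^ 2 ≤ 1 / 3 := by
  have h : 0 < 1 - ρ ^ 2 := by nlinarith
  rw [div_le_iff₀ h] at hρδ
  nlinarith [sq_nonneg δ]

/-- The incoherence of the residual block: with `S` the norm of the block `Q E Q` and `d` that of
`Q M Q`, the spectral gap forces `S` to be small compared with the norm `e` of the error. -/
lemma compl_block_scalar {e S d β : ℝ} (he : 0 < e) (hS : 0 ≤ S) (hSe : S ≤ e) (hρ : 0 < ρ)
    (hρ1 : ρ < 1) (hρβ : ρ ^ 2 / (1 - ρ ^ 2) ≤ β) (hel : e < ρ * l)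
    (hd1 : d ≤ 5 / 4 * S) (hd2 : 3 / 4 * S ≤ d) (hd : (l - d) * d ≤ (e ^ 2 - S ^ 2) / 2) :
    S ^ 2 ≤ β * e ^ 2 := by
  by_contra! hcon
  have h1 : 0 < 1 - ρ ^ 2 := by nlinarith
  have h2 : ρ ^ 2 * e ^ 2 < S ^ 2 * (1 - ρ ^ 2) := by
    have h3 : ρ ^ 2 / (1 - ρ ^ 2) * e ^ 2 < S ^ 2 :=
      (mul_le_mul_of_nonneg_right hρβ (by positivity)).trans_lt hcon
    rwa [div_mul_eq_mul_div, div_lt_iff₀ h1] at h3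
  have hS0 : 0 < S := by
    refine hS.lt_of_ne fun h => ?_
    rw [← h] at h2; nlinarith [sq_nonneg (ρ * e)]
  have hSS : S ^ 2 ≤ e ^ 2 := pow_le_pow_left₀ hS hSe 2
  -- `e² + 2/5 S² ≤ e √(e² + S²) < l S`
  have h4 : ρ * (e ^ 2 + 2 / 5 * S ^ 2) < e * S := by
    refine lt_of_pow_lt_pow_left₀ 2 (by positivity) ?_
    have h5 : (e ^ 2 + 2 / 5 * S ^ 2) ^ 2 ≤ e ^ 2 * (e ^ 2 + S ^ 2) := by
      nlinarith [mul_le_mul_of_nonneg_right hSS (sq_nonneg S)]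
    have h6 := mul_le_mul_of_nonneg_left h5 (sq_nonneg ρ)
    have h7 : e ^ 2 * (ρ ^ 2 * (e ^ 2 + S ^ 2)) < e ^ 2 * S ^ 2 :=
      mul_lt_mul_of_pos_left (by linarith) (by positivity)
    linarith
  have h8 : e ^ 2 + 2 / 5 * S ^ 2 < l * S := by
    have : ρ * (e ^ 2 + 2 / 5 * S ^ 2) < ρ * (l * S) := by nlinarith
    exact lt_of_mul_lt_mul_left this hρ.le
  obtain ⟨θ, rfl⟩ : ∃ θ, d = θ * S := ⟨d / S, by field_simp⟩
  have h9 : θ ≤ 5 / 4 := le_of_mul_le_mul_right hd1 hS0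
  have h10 : 3 / 4 ≤ θ := le_of_mul_le_mul_right hd2 hS0
  have h11 : θ * (e ^ 2 + 2 / 5 * S ^ 2) ≤ θ * (l * S) :=
    mul_le_mul_of_nonneg_left h8.le (by linarith)
  have h12 : 0 ≤ (θ - 1 / 2) * (e ^ 2 - S ^ 2) := mul_nonneg (by linarith) (by linarith)
  have h13 : 0 < (θ * (7 / 5 - θ)) * S ^ 2 :=
    mul_pos (mul_pos (by linarith) (by linarith)) (by positivity)
  nlinarith

/-- The orthogonal projection `P = X B Xᵀ` onto the span of the columns of `X` of squared norm at
least `t`, when the columns of `X` are orthogonal. It commutes with `X Xᵀ`, at most `r - k` columns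
are left out, and `W B` is controlled by `W B Xᵀ`. -/
lemma exists_large_projection (hs : Xᵀ * X = Matrix.diagonal s)
    (hgap : SpectralGap M l) (hrank : M.rank = k) (ht0 : 0 < t)
    (htl : t + ‖X * Xᵀ - M‖ < l) :
    ∃ B : Matrix (Fin r) (Fin r) ℝ, Bᵀ = B ∧ (X * B * Xᵀ) * (X * B * Xᵀ) = X * B * Xᵀ ∧
      (X * B * Xᵀ) * (X * Xᵀ) * (1 - X * B * Xᵀ) = 0 ∧
      ‖(1 - X * B * Xᵀ) * (X * Xᵀ) * (1 - X * B * Xᵀ)‖ ^ 2 ≤ ((r : ℝ) - k) * t ^ 2 ∧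
      ∀ W : Matrix (Fin n) (Fin r) ℝ, t * ‖W * B‖ ^ 2 ≤ ‖W * B * Xᵀ‖ ^ 2 := by
  have hs0 := gram_eigenvalue_nonneg hs
  set B : Matrix (Fin r) (Fin r) ℝ := Matrix.diagonal fun j => if t ≤ s j then (s j)⁻¹ else 0
    with hB
  set N : Matrix (Fin r) (Fin r) ℝ := Matrix.diagonal fun j => if t ≤ s j then 0 else 1 with hN
  have hBt : Bᵀ = B := Matrix.diagonal_transpose _
  have hBs : B * (Xᵀ * X) = 1 - N := by
    rw [hs, hB, hN, Matrix.diagonal_mul_diagonal, ← Matrix.diagonal_one, Matrix.diagonal_sub]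
    congr 1; ext j
    split_ifs with h
    · rw [inv_mul_cancel₀ (ht0.trans_le h).ne', sub_zero]
    · simp
  have hNB : N * B = 0 := by
    rw [hB, hN, Matrix.diagonal_mul_diagonal, ← Matrix.diagonal_zero]
    congr 1; ext j; split_ifs <;> simp
  set P := X * B * Xᵀ with hPdef
  have hP : P * P = P := by
    calc P * P = X * ((B * (Xᵀ * X)) * B) * Xᵀ := by rw [hPdef]; simp only [Matrix.mul_assoc]
      _ = P := by rw [hBs, Matrix.sub_mul, hNB, Matrix.one_mul, sub_zero]
  have hBs' : (Xᵀ * X) * B = 1 - N := by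
    have := congr_arg Matrix.transpose hBs
    rwa [Matrix.transpose_mul, hBt, Matrix.transpose_mul, Matrix.transpose_transpose,
      Matrix.transpose_sub, Matrix.transpose_one, hN, Matrix.diagonal_transpose] at this
  have hQX : (1 - P) * X = X * N := by
    calc (1 - P) * X = X - X * (B * (Xᵀ * X)) := by
          rw [hPdef, Matrix.sub_mul, Matrix.one_mul]; simp only [Matrix.mul_assoc]
      _ = X * N := by rw [hBs, Matrix.mul_sub, Matrix.mul_one, sub_sub_cancel]
  have hXQ : Xᵀ * (1 - P) = N * Xᵀ := by
    calc Xᵀ * (1 - P) = Xᵀ - ((Xᵀ * X) * B) * Xᵀ := by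
          rw [hPdef, Matrix.mul_sub, Matrix.mul_one]; simp only [Matrix.mul_assoc]
      _ = N * Xᵀ := by rw [hBs', Matrix.sub_mul, Matrix.one_mul, sub_sub_cancel]
  have hNN : N * N = N := by
    rw [hN, Matrix.diagonal_mul_diagonal]
    congr 1; ext j; split_ifs <;> simp
  -- the discarded part of `X Xᵀ` has at most `r - k` nonzero eigenvalues, all below `t`
  have hres : ‖(1 - P) * (X * Xᵀ) * (1 - P)‖ ^ 2 ≤ ((r : ℝ) - k) * t ^ 2 := by
    have h1 : (1 - P) * (X * Xᵀ) * (1 - P) = X * (N * Xᵀ) := by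
      calc (1 - P) * (X * Xᵀ) * (1 - P) = ((1 - P) * X) * (Xᵀ * (1 - P)) := by
            simp only [Matrix.mul_assoc]
        _ = X * ((N * N) * Xᵀ) := by rw [hQX, hXQ]; simp only [Matrix.mul_assoc]
        _ = X * (N * Xᵀ) := by rw [hNN]
    have h2 : ‖X * (N * Xᵀ)‖ ^ 2 = ∑ j, if t ≤ s j then 0 else s j ^ 2 := by
      rw [← fip_self, fip_mul_left, ← Matrix.mul_assoc Xᵀ, ← Matrix.mul_assoc (Xᵀ * X),
        fip_mul_right, Matrix.transpose_transpose, hs, Matrix.mul_assoc, hs, hN,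
        Matrix.diagonal_mul_diagonal, Matrix.diagonal_mul_diagonal, fip_eq_trace,
        Matrix.diagonal_transpose, Matrix.diagonal_mul_diagonal, Matrix.trace_diagonal]
      refine Finset.sum_congr rfl fun j _ => ?_
      split_ifs <;> simp [sq]
    have h3 : k ≤ (Finset.univ.filter fun j => t ≤ s j).card :=
      rank_le_card_large hs hgap ht0.le hrank htl
    have h4 : (Finset.univ.filter fun j => ¬ t ≤ s j).card + k ≤ r := by
      have := Finset.card_filter_add_card_filter_not (s := (Finset.univ : Finset (Fin r)))
        (fun j => t ≤ s j)
      rw [Finset.card_univ, Fintype.card_fin] at this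
      omega
    have h4' : ((Finset.univ.filter fun j => ¬ t ≤ s j).card : ℝ) + k ≤ r := by exact_mod_cast h4
    rw [h1, h2]
    calc ∑ j, (if t ≤ s j then 0 else s j ^ 2) ≤ ∑ j, (if ¬ t ≤ s j then t ^ 2 else 0) := by
          refine Finset.sum_le_sum fun j _ => ?_
          split_ifs with h
          · exact le_rfl
          · exact pow_le_pow_left₀ (hs0 j) (not_le.1 h).le 2
      _ = (Finset.univ.filter fun j => ¬ t ≤ s j).card * t ^ 2 := by
          rw [← Finset.sum_filter, Finset.sum_const, nsmul_eq_mul]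
      _ ≤ ((r : ℝ) - k) * t ^ 2 :=
          mul_le_mul_of_nonneg_right (by linarith) (by positivity)
  have hPQ : P * (X * Xᵀ) * (1 - P) = 0 := by
    have h2 : B * ((Xᵀ * X) * N) = 0 := by
      rw [← Matrix.mul_assoc, hBs, Matrix.sub_mul, hNN, Matrix.one_mul, sub_self]
    calc P * (X * Xᵀ) * (1 - P) = X * B * Xᵀ * X * (Xᵀ * (1 - P)) := by
          rw [hPdef]; simp only [Matrix.mul_assoc]
      _ = X * (B * ((Xᵀ * X) * N)) * Xᵀ := by rw [hXQ]; simp only [Matrix.mul_assoc]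
      _ = 0 := by rw [h2]; simp
  refine ⟨B, hBt, hP, hPQ, hres, fun W => ?_⟩
  have h1 : ‖W * B * Xᵀ‖ ^ 2 = ∑ i, ∑ j, s j * (W * B) i j ^ 2 := by
    rw [← fip_self, fip_mul_right, Matrix.transpose_transpose, Matrix.mul_assoc (W * B), hs,
      fip_apply]
    refine Finset.sum_congr rfl fun i _ => Finset.sum_congr rfl fun j _ => ?_
    rw [Matrix.mul_diagonal s (W * B)]; ring
  rw [h1, ← fip_self, fip_apply, Finset.mul_sum]
  refine Finset.sum_le_sum fun i _ => ?_
  rw [Finset.mul_sum]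
  refine Finset.sum_le_sum fun j _ => ?_
  by_cases hj : t ≤ s j
  · nlinarith [sq_nonneg ((W * B) i j)]
  · have : (W * B) i j = 0 := by rw [hB, Matrix.mul_diagonal, if_neg hj, mul_zero]
    rw [this]; simp

/-- Outside the range of a projection commuting with `X Xᵀ` that leaves little of `X Xᵀ`, the
error `X Xᵀ - M` has only a small part of its norm. -/
lemma norm_compl_block_sq_le {P : Matrix (Fin n) (Fin n) ℝ} (hPt : Pᵀ = P) (hP : P * P = P)
    (hM : M.PosSemidef) (hgap : SpectralGap M l) (hl : 0 ≤ l) (hρ : 0 < ρ) (hρ1 : ρ < 1)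
    (hρδ : ρ ^ 2 / (1 - ρ ^ 2) ≤ (1 - δ ^ 2) / 2) (he : ‖X * Xᵀ - M‖ < ρ * l)
    (he0 : 0 < ‖X * Xᵀ - M‖) (hPX : P * (X * Xᵀ) * (1 - P) = 0)
    (hres : ‖(1 - P) * (X * Xᵀ) * (1 - P)‖ ^ 2 ≤ (1 - δ ^ 2) / 36 * ‖X * Xᵀ - M‖ ^ 2) :
    ‖(1 - P) * (X * Xᵀ - M) * (1 - P)‖ ^ 2 ≤ (1 - δ ^ 2) / 2 * ‖X * Xᵀ - M‖ ^ 2 := by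
  have hMt : Mᵀ = M := by simpa using hM.1.eq
  set E := X * Xᵀ - M with hE
  have hEt : Eᵀ = E := by rw [hE, Matrix.transpose_sub, Matrix.transpose_mul, hMt]; simp
  have hsplit : (1 - P) * (X * Xᵀ) * (1 - P) =
      (1 - P) * E * (1 - P) + (1 - P) * M * (1 - P) := by
    rw [← add_mul, ← mul_add, hE, sub_add_cancel]
  have hPEQ : P * E * (1 - P) = -(P * M * (1 - P)) := by
    calc P * E * (1 - P) = P * (X * Xᵀ) * (1 - P) - P * M * (1 - P) := by
          rw [hE, Matrix.mul_sub P, Matrix.sub_mul]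
      _ = -(P * M * (1 - P)) := by rw [hPX, zero_sub]
  have h1 := hgap.block_le hM hl hPt hP
  have h2 := norm_sub_compl_block_sq_eq hPt hP hEt
  rw [norm_sub_compl_block_sq hPt hP, hPEQ, norm_neg] at h2
  have h4 : ‖(1 - P) * M * (1 - P)‖ ≤
      ‖(1 - P) * E * (1 - P)‖ + ‖(1 - P) * (X * Xᵀ) * (1 - P)‖ := by
    have h : (1 - P) * M * (1 - P) = (1 - P) * (X * Xᵀ) * (1 - P) - (1 - P) * E * (1 - P) := by
      rw [hsplit]; abel
    rw [h, add_comm]; exact norm_sub_le _ _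
  have h5 : ‖(1 - P) * E * (1 - P)‖ ≤
      ‖(1 - P) * M * (1 - P)‖ + ‖(1 - P) * (X * Xᵀ) * (1 - P)‖ := by
    have h : (1 - P) * E * (1 - P) = (1 - P) * (X * Xᵀ) * (1 - P) - (1 - P) * M * (1 - P) := by
      rw [hsplit]; abel
    rw [h, add_comm]; exact norm_sub_le _ _
  by_contra! hcon
  have hS0 : 0 ≤ ‖(1 - P) * E * (1 - P)‖ := norm_nonneg _
  have h3 : ‖(1 - P) * (X * Xᵀ) * (1 - P)‖ ≤ ‖(1 - P) * E * (1 - P)‖ / 4 := by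
    refine le_of_sq_le_sq ?_ (by positivity)
    linarith [sq_nonneg ‖(1 - P) * E * (1 - P)‖]
  have h7 := sq_nonneg ‖P * E * P‖
  have h8 := sq_nonneg ‖P * M * (1 - P)‖
  have h6 : ‖(1 - P) * E * (1 - P)‖ ≤ ‖E‖ := le_of_sq_le_sq (by linarith) (norm_nonneg _)
  exact absurd (compl_block_scalar he0 hS0 h6 hρ hρ1 hρδ he (d := ‖(1 - P) * M * (1 - P)‖)
    (by linarith) (by linarith) (by linarith)) (not_le.2 hcon)

/-- A direction along which the noiseless loss has a large slope compared with the preconditioned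
norm, when the columns of `X` are orthogonal: the projection `E - Q E Q` of the error `E`, where
`Q` removes the columns of `X` of squared norm at least `t`. -/
lemma exists_dominating_direction_of_diagonal (hs : Xᵀ * X = Matrix.diagonal s)
    (hM : M.PosSemidef) (hgap : SpectralGap M l) (hl : 0 ≤ l) (hrank : M.rank = k) (hkr : k ≤ r)
    (hρ : 0 < ρ) (hρ1 : ρ < 1)
    (hρδ : ρ ^ 2 / (1 - ρ ^ 2) ≤ (1 - δ ^ 2) / 2) (he : ‖X * Xᵀ - M‖ < ρ * l)
    (he0 : 0 < ‖X * Xᵀ - M‖) (ht0 : 0 < t) (ht : t ≤ ‖X * Xᵀ - M‖ / 4)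
    (htr : ((r : ℝ) - k) * t ^ 2 ≤ (1 - δ ^ 2) / 36 * ‖X * Xᵀ - M‖ ^ 2) :
    ∃ Y : Matrix (Fin n) (Fin r) ℝ,
      (∀ a b : ℝ, (a • (X * Xᵀ - M) + b • symProd X Y).rank ≤ 2 * r) ∧
      fip (X * Xᵀ - M) (symProd X Y) = ‖symProd X Y‖ ^ 2 ∧
      (1 + δ ^ 2) / 2 * ‖X * Xᵀ - M‖ ^ 2 ≤ ‖symProd X Y‖ ^ 2 ∧
      2 * ‖Y * Xᵀ‖ ^ 2 ≤ ‖symProd X Y‖ ^ 2 ∧ t * ‖Y‖ ^ 2 ≤ ‖Y * Xᵀ‖ ^ 2 := by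
  set E := X * Xᵀ - M with hE
  have hMt : Mᵀ = M := by simpa using hM.1.eq
  have hEt : Eᵀ = E := by rw [hE, Matrix.transpose_sub, Matrix.transpose_mul, hMt]; simp
  have htl : t + ‖E‖ < l := by
    have hρ3 := sq_le_third_of_basin hρ hρ1 hρδ
    have hρ4 : ρ < 4 / 5 := by nlinarith
    nlinarith
  obtain ⟨B, hBt, hP, hPX, hres, hBW⟩ := exists_large_projection hs hgap hrank ht0 htl
  set P := X * B * Xᵀ with hPdef
  have hPt : Pᵀ = P := by
    rw [hPdef, Matrix.transpose_mul, Matrix.transpose_mul, hBt, Matrix.transpose_transpose,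
      Matrix.mul_assoc]
  have hSe := norm_compl_block_sq_le hPt hP hM hgap hl hρ hρ1 hρδ he he0 hPX (hres.trans htr)
  rw [← hE] at hSe
  set Y := (E - (1 / 2 : ℝ) • (P * E)) * X * B with hY
  have hYX : Y * Xᵀ = E * P - (1 / 2 : ℝ) • (P * E * P) := by
    rw [hY, Matrix.mul_assoc _ X, Matrix.mul_assoc, ← hPdef, Matrix.sub_mul, Matrix.smul_mul]
  have hXY : X * Yᵀ = P * E - (1 / 2 : ℝ) • (P * E * P) := by
    have : X * Yᵀ = (Y * Xᵀ)ᵀ := by simp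
    rw [this, hYX]
    simp [hPt, hEt, Matrix.mul_assoc]
  have hF : symProd X Y = E - (1 - P) * E * (1 - P) := by
    have h : (1 - P) * E * (1 - P) = E - P * E - E * P + P * E * P := by noncomm_ring
    rw [symProd_apply, hYX, hXY, h]
    module
  have hFn : ‖symProd X Y‖ ^ 2 = ‖E‖ ^ 2 - ‖(1 - P) * E * (1 - P)‖ ^ 2 := by
    rw [hF, norm_sub_compl_block_sq hPt hP]
  refine ⟨Y, fun a b => ?_, ?_, ?_, ?_, ?_⟩
  · have h1 : Y * Xᵀ = X * (Xᵀ * P - (1 / 2 : ℝ) • (B * Xᵀ * E * P)) + M * (-P) := by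
      have h1 : P * E * P = X * (B * Xᵀ * E * P) := by
        calc P * E * P = (X * B * Xᵀ) * E * P := by rw [← hPdef]
          _ = X * (B * Xᵀ * E * P) := by simp only [Matrix.mul_assoc]
      have h2 : E * P = X * (Xᵀ * P) + M * (-P) := by
        rw [hE, Matrix.sub_mul, Matrix.mul_neg, Matrix.mul_assoc]; abel
      rw [hYX, h1, h2, Matrix.mul_sub X, Matrix.mul_smul]
      abel
    have h2 : a • E + b • symProd X Y =
        X * (a • Xᵀ + b • (Yᵀ + (Xᵀ * P - (1 / 2 : ℝ) • (B * Xᵀ * E * P)))) +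
          M * (-(a • (1 : Matrix (Fin n) (Fin n) ℝ)) + b • (-P)) := by
      rw [symProd_apply, h1]
      simp only [Matrix.mul_add, Matrix.mul_smul, Matrix.mul_neg, Matrix.mul_one]
      conv_lhs => rw [hE]
      module
    rw [h2]
    refine (rank_mul_add_mul_le _ _ _ _).trans ?_
    have := X.rank_le_width
    omega
  · rw [hFn, hF, fip_sub_compl_block hPt hP]
  · rw [hFn]; linarith
  · rw [hYX, hF]; exact two_mul_norm_half_block_sq_le hPt hP hEt
  · rw [hY]; exact hBW _

/-- Every factor can be rotated into one with orthogonal columns. -/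
lemma exists_rotation (X : Matrix (Fin n) (Fin r) ℝ) :
    ∃ (V : Matrix (Fin r) (Fin r) ℝ) (s : Fin r → ℝ), Vᵀ * V = 1 ∧ V * Vᵀ = 1 ∧
      (X * V)ᵀ * (X * V) = Matrix.diagonal s := by
  have h : (Xᵀ * X).IsHermitian := by
    simpa using (Matrix.posSemidef_conjTranspose_mul_self X).1
  obtain ⟨V, h1, h2, h3⟩ := exists_orthogonal_diagonalization h
  refine ⟨V, h.eigenvalues, h1, h2, ?_⟩
  calc (X * V)ᵀ * (X * V) = Vᵀ * (Xᵀ * X) * V := by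
        rw [Matrix.transpose_mul]; simp only [Matrix.mul_assoc]
    _ = (Vᵀ * V) * Matrix.diagonal h.eigenvalues * (Vᵀ * V) := by
        conv_lhs => rw [h3]
        simp only [Matrix.mul_assoc]
    _ = Matrix.diagonal h.eigenvalues := by rw [h1, Matrix.one_mul, Matrix.mul_one]

lemma norm_mul_orthogonal {V : Matrix (Fin r) (Fin r) ℝ} (hV : V * Vᵀ = 1)
    (Y : Matrix (Fin n) (Fin r) ℝ) : ‖Y * V‖ = ‖Y‖ := by
  refine (sq_eq_sq₀ (norm_nonneg _) (norm_nonneg _)).1 ?_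
  rw [← fip_self, ← fip_self, fip_mul_right, Matrix.mul_assoc, hV, Matrix.mul_one]

/-- The direction of `exists_dominating_direction_of_diagonal` for an arbitrary factor `X`. -/
lemma exists_dominating_direction (X : Matrix (Fin n) (Fin r) ℝ)
    (hM : M.PosSemidef) (hgap : SpectralGap M l) (hl : 0 ≤ l) (hrank : M.rank = k) (hkr : k ≤ r)
    (hρ : 0 < ρ) (hρ1 : ρ < 1)
    (hρδ : ρ ^ 2 / (1 - ρ ^ 2) ≤ (1 - δ ^ 2) / 2) (he : ‖X * Xᵀ - M‖ < ρ * l)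
    (he0 : 0 < ‖X * Xᵀ - M‖) (ht0 : 0 < t) (ht : t ≤ ‖X * Xᵀ - M‖ / 4)
    (htr : ((r : ℝ) - k) * t ^ 2 ≤ (1 - δ ^ 2) / 36 * ‖X * Xᵀ - M‖ ^ 2) :
    ∃ Y : Matrix (Fin n) (Fin r) ℝ,
      (∀ a b : ℝ, (a • (X * Xᵀ - M) + b • symProd X Y).rank ≤ 2 * r) ∧
      fip (X * Xᵀ - M) (symProd X Y) = ‖symProd X Y‖ ^ 2 ∧
      (1 + δ ^ 2) / 2 * ‖X * Xᵀ - M‖ ^ 2 ≤ ‖symProd X Y‖ ^ 2 ∧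
      2 * ‖Y * Xᵀ‖ ^ 2 ≤ ‖symProd X Y‖ ^ 2 ∧ t * ‖Y‖ ^ 2 ≤ ‖Y * Xᵀ‖ ^ 2 := by
  obtain ⟨V, s, hV1, hV2, hs⟩ := exists_rotation X
  have hXX : (X * V) * (X * V)ᵀ = X * Xᵀ := by
    rw [Matrix.transpose_mul, Matrix.mul_assoc, ← Matrix.mul_assoc V, hV2, Matrix.one_mul]
  rw [← hXX] at he he0 ht htr
  obtain ⟨Y, h1, h2, h3, h4, h5⟩ := exists_dominating_direction_of_diagonal hs hM hgap hl hrank hkr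
    hρ hρ1 hρδ he he0 ht0 ht htr
  have hYX : Y * (X * V)ᵀ = (Y * Vᵀ) * Xᵀ := by rw [Matrix.transpose_mul, Matrix.mul_assoc]
  have hsym : symProd (X * V) Y = symProd X (Y * Vᵀ) := by
    rw [symProd_apply, symProd_apply, hYX, Matrix.transpose_mul, Matrix.transpose_transpose,
      Matrix.mul_assoc]
  have hYn : ‖Y‖ = ‖Y * Vᵀ‖ := (norm_mul_orthogonal (by simpa using hV1) Y).symm
  rw [hXX, hsym] at h2 h3
  rw [hYX, hsym] at h4
  rw [hYX, hYn] at h5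
  refine ⟨Y * Vᵀ, fun a b => ?_, h2, h3, h4, h5⟩
  have := h1 a b
  rwa [hXX, hsym] at this

end Dominance

section Constant

variable {δ : ℝ} {r k : ℕ}

lemma slope_pos (hδ : 0 ≤ δ) (hδ1 : δ < 1) : 0 < √((1 + δ ^ 2) / 2) - δ := by
  rw [sub_pos, Real.lt_sqrt hδ]; nlinarith

lemma muP_pos (hδ : 0 ≤ δ) (hδ1 : δ < 1) : 0 < muP δ r k := by
  have h1 := slope_pos hδ hδ1
  have h2 : 0 < √2 - 1 := by rw [sub_pos, Real.lt_sqrt zero_le_one]; norm_num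
  unfold muP muPL
  refine mul_pos (by positivity) (lt_min ?_ ?_) <;> positivity

/-- `muP` in terms of the reciprocal relative threshold `W` below which columns of `X` are
discarded. -/
lemma muP_le {W : ℝ} (hW : W = max (1 / (√2 - 1)) (3 * √(((r : ℝ) - k) / (1 - δ ^ 2)))) :
    muP δ r k ≤ (√((1 + δ ^ 2) / 2) - δ) ^ 2 * (1 + √(1 + δ) * W)⁻¹ := by
  unfold muP muPL
  refine mul_le_mul_of_nonneg_left ?_ (sq_nonneg _)
  rcases max_choice (1 / (√2 - 1)) (3 * √(((r : ℝ) - k) / (1 - δ ^ 2))) with h | h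
  · rw [hW, h, mul_one_div]; exact min_le_left _ _
  · rw [hW, h, show √(1 + δ) * (3 * √(((r : ℝ) - k) / (1 - δ ^ 2))) =
      3 * √(1 + δ) * √(((r : ℝ) - k) / (1 - δ ^ 2)) by ring]
    exact min_le_right _ _

lemma muP_le_one (hδ : 0 ≤ δ) (hδ1 : δ < 1) : muP δ r k ≤ 1 := by
  have h1 := slope_pos hδ hδ1
  have h2 : √((1 + δ ^ 2) / 2) ≤ 1 := Real.sqrt_le_iff.2 ⟨zero_le_one, by nlinarith⟩
  have h3 : 0 < √2 - 1 := by rw [sub_pos, Real.lt_sqrt zero_le_one]; norm_num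
  have hW : 0 ≤ max (1 / (√2 - 1)) (3 * √(((r : ℝ) - k) / (1 - δ ^ 2))) :=
    le_max_of_le_left (by positivity)
  calc muP δ r k ≤ _ := muP_le rfl
    _ ≤ 1 * 1 := by
      refine mul_le_mul (by nlinarith) (inv_le_one_of_one_le₀ ?_) (by positivity) zero_le_one
      have := mul_nonneg (Real.sqrt_nonneg (1 + δ)) hW
      linarith
    _ = 1 := one_mul 1

end Constant

section Dominance

variable {n m r k : ℕ} {A : Fin m → Matrix (Fin n) (Fin n) ℝ} {M : Matrix (Fin n) (Fin n) ℝ}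
  {l δ ρ η : ℝ}

lemma rank_error_le (X : Matrix (Fin n) (Fin r) ℝ) (hrank : M.rank = k) (hkr : k ≤ r) :
    (X * Xᵀ - M).rank ≤ 2 * r := by
  have h := rank_mul_add_mul_le X Xᵀ M (-1)
  rw [Matrix.mul_neg, Matrix.mul_one, ← sub_eq_add_neg] at h
  have := X.rank_le_width
  omega

/-- The Cauchy-Schwarz lower bound `c² / ‖Y‖_P²` for the squared gradient norm `p`, where `c` is the
slope along `Y`, `f = ‖X Yᵀ + Y Xᵀ‖`, `g = ‖Y Xᵀ‖` and `w = ‖Y‖`. -/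
lemma dominance_scalar {μ κ δ η e f g w p c C W : ℝ} (hμ : 0 ≤ μ) (hκ : 0 ≤ κ - δ) (he : 0 < e)
    (hf : 0 < f) (hp : 0 ≤ p) (hC : 0 ≤ C) (hW : 0 ≤ W) (hc : 2 * (f * (f - δ * e)) ≤ c)
    (hκe : κ * e ≤ f) (hηe : η ≤ C * e) (hη2 : η ^ 2 ≤ 2 * e ^ 2)
    (hw : e * w ^ 2 ≤ 2 * W * g ^ 2) (hg : 2 * g ^ 2 ≤ f ^ 2)
    (hcs : c ^ 2 ≤ p * (g ^ 2 + η * w ^ 2)) (hμW : μ * (1 + C * W) ≤ (κ - δ) ^ 2) :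
    2 * μ * η ^ 2 ≤ p := by
  have hc' : 2 * (f * ((κ - δ) * e)) ≤ c := by
    have : f * ((κ - δ) * e) ≤ f * (f - δ * e) := mul_le_mul_of_nonneg_left (by linarith) hf.le
    linarith
  have hCW : 0 ≤ C * W := mul_nonneg hC hW
  -- `η ‖Y‖² ≤ (η / t) ‖Y Xᵀ‖²` with `η / t ≤ 2 C W`
  have hηw : η * w ^ 2 ≤ 2 * (C * W) * g ^ 2 := by
    calc η * w ^ 2 ≤ C * e * w ^ 2 := mul_le_mul_of_nonneg_right hηe (sq_nonneg w)
      _ = C * (e * w ^ 2) := by ring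
      _ ≤ C * (2 * W * g ^ 2) := mul_le_mul_of_nonneg_left hw hC
      _ = 2 * (C * W) * g ^ 2 := by ring
  have hY : g ^ 2 + η * w ^ 2 ≤ (1 + C * W) * f ^ 2 := by
    linarith [mul_le_mul_of_nonneg_left hg hCW, sq_nonneg g]
  have h1 : (2 * (f * ((κ - δ) * e))) ^ 2 ≤ p * ((1 + C * W) * f ^ 2) :=
    (pow_le_pow_left₀ (by positivity) hc' 2).trans
      (hcs.trans (mul_le_mul_of_nonneg_left hY hp))
  have h2 : 4 * ((κ - δ) ^ 2 * e ^ 2) ≤ p * (1 + C * W) := by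
    have : 4 * ((κ - δ) ^ 2 * e ^ 2) * f ^ 2 ≤ p * (1 + C * W) * f ^ 2 := by linarith
    exact le_of_mul_le_mul_right this (by positivity)
  have h4 : 4 * (μ * e ^ 2) ≤ p := by
    have : 4 * (μ * e ^ 2) * (1 + C * W) ≤ p * (1 + C * W) := by
      linarith [mul_le_mul_of_nonneg_right hμW (sq_nonneg e)]
    exact le_of_mul_le_mul_right this (by linarith)
  linarith [mul_le_mul_of_nonneg_left hη2 hμ]

/-- Gradient dominance in the preconditioned norm: in the basin, the squared preconditioned norm of
the gradient of the noiseless loss is at least `2 μ_P` times the loss. -/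
lemma two_mul_muP_mul_sq_le (X D : Matrix (Fin n) (Fin r) ℝ) (hA : RIP A (2 * r) δ)
    (hM : M.PosSemidef) (hgap : SpectralGap M l) (hl : 0 ≤ l) (hrank : M.rank = k) (hkr : k ≤ r)
    (hδ : 0 ≤ δ) (hδ1 : δ < 1) (hρ : 0 < ρ) (hρ1 : ρ < 1)
    (hρδ : ρ ^ 2 / (1 - ρ ^ 2) ≤ (1 - δ ^ 2) / 2) (hη : 0 < η)
    (hE : bform A (X * Xᵀ - M) (X * Xᵀ - M) = η ^ 2)
    (hbasin : η ^ 2 < ρ ^ 2 * (1 - δ) * l ^ 2)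
    (hD : ∀ Y, pip X η D Y = 2 * bform A (X * Xᵀ - M) (symProd X Y)) :
    2 * muP δ r k * η ^ 2 ≤ pip X η D D := by
  have hlow := hA.lower (rank_error_le X hrank hkr)
  have hupp := hA.upper (rank_error_le X hrank hkr)
  rw [hE] at hlow hupp
  have he0 : 0 < ‖X * Xᵀ - M‖ := by
    refine (norm_nonneg _).lt_of_ne fun h => ?_
    rw [← h] at hupp
    nlinarith [pow_pos hη 2]
  have he : ‖X * Xᵀ - M‖ < ρ * l := by
    refine lt_of_pow_lt_pow_left₀ 2 (by positivity) ?_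
    have : (1 - δ) * ‖X * Xᵀ - M‖ ^ 2 < (1 - δ) * (ρ * l) ^ 2 := by nlinarith
    exact lt_of_mul_lt_mul_left this (by linarith)
  obtain ⟨W, hW⟩ : ∃ W, W = max (1 / (√2 - 1)) (3 * √(((r : ℝ) - k) / (1 - δ ^ 2))) := ⟨_, rfl⟩
  have hμ := muP_le (δ := δ) (r := r) (k := k) hW
  have hrk : (0 : ℝ) ≤ (r : ℝ) - k := sub_nonneg.2 (Nat.cast_le.2 hkr)
  have hδ2 : 0 < 1 - δ ^ 2 := by nlinarith
  have hW2 : 2 ≤ W := by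
    have h1 : 0 < √2 - 1 := by rw [sub_pos, Real.lt_sqrt zero_le_one]; norm_num
    have h2 : √2 ≤ 3 / 2 := by rw [Real.sqrt_le_left (by norm_num)]; norm_num
    refine le_trans ?_ (hW ▸ le_max_left _ _)
    rw [le_div_iff₀ h1]; linarith
  have hW9 : 9 * ((r : ℝ) - k) ≤ (1 - δ ^ 2) * W ^ 2 := by
    have h1 : 3 * √(((r : ℝ) - k) / (1 - δ ^ 2)) ≤ W := hW ▸ le_max_right _ _
    have h2 := pow_le_pow_left₀ (by positivity) h1 2
    rw [mul_pow, Real.sq_sqrt (by positivity), mul_div_assoc', div_le_iff₀ hδ2] at h2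
    linarith
  have hdir := exists_dominating_direction X hM hgap hl hrank hkr hρ hρ1 hρδ he he0
    (t := ‖X * Xᵀ - M‖ / (2 * W)) (by positivity)
    (div_le_div_of_nonneg_left he0.le (by norm_num) (by linarith))
    (by
      rw [div_pow, mul_div_assoc', div_le_iff₀ (by positivity)]
      nlinarith [mul_le_mul_of_nonneg_right hW9 (sq_nonneg ‖X * Xᵀ - M‖)])
  obtain ⟨Y, hYr, hYF, hYe, hYX, hYt⟩ := hdir
  have hpol := hA.polarization (by simpa using hYr)
  rw [hYF] at hpol
  have hDY := hD Y
  have hcs := pip_sq_le hη.le X D Y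
  have hp0 := pip_self_nonneg hη.le X D
  rw [pip_self X Y] at hcs
  have hκ := slope_pos hδ hδ1
  have hκe : √((1 + δ ^ 2) / 2) * ‖X * Xᵀ - M‖ ≤ ‖symProd X Y‖ := by
    refine le_of_sq_le_sq ?_ (norm_nonneg _)
    rwa [mul_pow, Real.sq_sqrt (by positivity)]
  have hηe : η ≤ √(1 + δ) * ‖X * Xᵀ - M‖ := by
    refine le_of_sq_le_sq ?_ (by positivity)
    rwa [mul_pow, Real.sq_sqrt (by positivity)]
  have hw : ‖X * Xᵀ - M‖ * ‖Y‖ ^ 2 ≤ 2 * W * ‖Y * Xᵀ‖ ^ 2 := by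
    rwa [div_mul_eq_mul_div, div_le_iff₀ (by linarith), mul_comm _ (2 * W)] at hYt
  have hμW : muP δ r k * (1 + √(1 + δ) * W) ≤ (√((1 + δ ^ 2) / 2) - δ) ^ 2 := by
    rwa [← div_eq_mul_inv, le_div_iff₀ (by positivity)] at hμ
  refine dominance_scalar (muP_pos hδ hδ1).le hκ.le he0
    (lt_of_lt_of_le (mul_pos (by linarith) he0) hκe) hp0 (Real.sqrt_nonneg (1 + δ)) (by linarith)
    ?_ hκe hηe ?_ hw hYX hcs hμW
  · rw [hDY]; linarith
  · nlinarith [sq_nonneg ‖X * Xᵀ - M‖]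

end Dominance

/-! ### The effect of the noise on the gradient -/

section Noise

variable {n m r : ℕ} {T : Matrix (Fin n) (Fin n) ℝ} {ω η : ℝ}

/-- A matrix of operator norm at most `ω` has inner product at most `ω √r ‖X Yᵀ‖` with a matrix
`X Yᵀ` with `r` columns. -/
lemma fip_mul_transpose_sq_le (hT : ∀ u v : Fin n → ℝ,
      (u ⬝ᵥ T *ᵥ v) ^ 2 ≤ ω ^ 2 * ((u ⬝ᵥ u) * (v ⬝ᵥ v)))
    (X Y : Matrix (Fin n) (Fin r) ℝ) :
    fip T (X * Yᵀ) ^ 2 ≤ r * (ω ^ 2 * ‖Y * Xᵀ‖ ^ 2) := by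
  obtain ⟨V, s, -, hV2, hs⟩ := exists_rotation X
  have hrot : ∀ U W : Matrix (Fin n) (Fin r) ℝ, (U * V) * (W * V)ᵀ = U * Wᵀ := fun U W => by
    rw [Matrix.transpose_mul, Matrix.mul_assoc, ← Matrix.mul_assoc V, hV2, Matrix.one_mul]
  rw [← hrot X Y, ← hrot Y X]
  generalize X * V = X at *
  generalize Y * V = Y at *
  have h1 : X * Yᵀ = ∑ j, Matrix.vecMulVec (fun i => X i j) (fun i => Y i j) := by
    ext a b
    simp [Matrix.mul_apply, Matrix.sum_apply, Matrix.vecMulVec_apply]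
  have h2 : ‖Y * Xᵀ‖ ^ 2 = ∑ j, s j * ((fun i => Y i j) ⬝ᵥ fun i => Y i j) := by
    rw [← fip_self, fip_mul_right, Matrix.transpose_transpose, Matrix.mul_assoc, hs, fip_apply,
      Finset.sum_comm]
    refine Finset.sum_congr rfl fun j _ => ?_
    rw [dotProduct, Finset.mul_sum]
    refine Finset.sum_congr rfl fun i _ => ?_
    rw [Matrix.mul_diagonal]; ring
  have h3 : ∀ j, ((fun i => X i j) ⬝ᵥ fun i => X i j) = s j := fun j => by
    have : (Xᵀ * X) j j = s j := by rw [hs]; simp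
    rw [← this]; rfl
  rw [h1, map_sum, h2]
  refine (sq_sum_le_card_mul_sum_sq).trans ?_
  rw [Finset.card_univ, Fintype.card_fin, Finset.mul_sum _ _ (ω ^ 2)]
  refine mul_le_mul_of_nonneg_left (Finset.sum_le_sum fun j _ => ?_) (Nat.cast_nonneg r)
  rw [fip_vecMulVec, ← h3]
  exact hT _ _

/-- The preconditioned norm of the noise part of the gradient. -/
lemma pip_noise_le (hη : 0 ≤ η) (hT : ∀ u v : Fin n → ℝ,
      (u ⬝ᵥ T *ᵥ v) ^ 2 ≤ ω ^ 2 * ((u ⬝ᵥ u) * (v ⬝ᵥ v)))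
    {X D : Matrix (Fin n) (Fin r) ℝ}
    (hD : ∀ Y, pip X η D Y = -(2 / (m : ℝ) * fip T (symProd X Y))) :
    pip X η D D ≤ 16 * r * ω ^ 2 / (m : ℝ) ^ 2 := by
  have hT' : ∀ u v : Fin n → ℝ, (u ⬝ᵥ Tᵀ *ᵥ v) ^ 2 ≤ ω ^ 2 * ((u ⬝ᵥ u) * (v ⬝ᵥ v)) := by
    intro u v
    rw [Matrix.mulVec_transpose, dotProduct_comm, ← Matrix.dotProduct_mulVec, mul_comm (u ⬝ᵥ u)]
    exact hT v u
  have h1 := fip_mul_transpose_sq_le hT X D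
  have h2 := fip_mul_transpose_sq_le hT' X D
  rw [← fip_transpose_right, Matrix.transpose_mul, Matrix.transpose_transpose] at h2
  have h3 : fip T (symProd X D) ^ 2 ≤ 4 * (r * (ω ^ 2 * ‖D * Xᵀ‖ ^ 2)) := by
    rw [symProd_apply, map_add]
    nlinarith [sq_nonneg (fip T (X * Dᵀ) - fip T (D * Xᵀ))]
  have h4 : ‖D * Xᵀ‖ ^ 2 ≤ pip X η D D := by
    rw [pip_self]
    have : 0 ≤ η * ‖D‖ ^ 2 := by positivity
    linarith
  have h5 : pip X η D D * pip X η D D ≤ 16 * r * ω ^ 2 / (m : ℝ) ^ 2 * pip X η D D := by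
    calc pip X η D D * pip X η D D = 4 / (m : ℝ) ^ 2 * fip T (symProd X D) ^ 2 := by
          rw [hD D]; ring
      _ ≤ 4 / (m : ℝ) ^ 2 * (4 * (r * (ω ^ 2 * pip X η D D))) := by
          refine mul_le_mul_of_nonneg_left (h3.trans ?_) (by positivity)
          have : (0 : ℝ) ≤ r * ω ^ 2 := by positivity
          nlinarith
      _ = 16 * r * ω ^ 2 / (m : ℝ) ^ 2 * pip X η D D := by ring
  rcases (pip_self_nonneg hη X D).eq_or_lt with h | h
  · rw [← h]; positivity
  · exact le_of_mul_le_mul_right h5 h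

end Noise

/-! ### Convergence up to the noise level -/

section Convergence

variable {n m r k : ℕ} {A : Fin m → Matrix (Fin n) (Fin n) ℝ} {M : Matrix (Fin n) (Fin n) ℝ}
  {δ ρ α ω : ℝ} {e : Fin m → ℝ}

/-- Above the noise level, one step contracts the noiseless loss and stays in the basin. -/
lemma damping_step_sq_le (hA : RIP A (2 * r) δ) (hk : 0 < k) (hkr : k ≤ r) (hM : M.PosSemidef)
    (hrank : M.rank = k) (hδ : 0 ≤ δ) (hδ1 : δ < 1) (hρ : 0 < ρ) (hρ1 : ρ < 1)
    (hρδ : ρ ^ 2 / (1 - ρ ^ 2) ≤ (1 - δ ^ 2) / 2) (hα : 0 < α) (hα1 : α ≤ 1 / 4000)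
    (hT : ∀ u v : Fin n → ℝ,
      (u ⬝ᵥ (∑ i, e i • A i) *ᵥ v) ^ 2 ≤ ω ^ 2 * ((u ⬝ᵥ u) * (v ⬝ᵥ v)))
    (X : Matrix (Fin n) (Fin r) ℝ)
    (hbasin : damping A M X ^ 2 < ρ ^ 2 * (1 - δ) * eigval M k ^ 2)
    (hnoise : 64 * r * ω ^ 2 / (m : ℝ) ^ 2 < muP δ r k * damping A M X ^ 2) :
    damping A M (X - α • (grad (loss A (sensing A M + WithLp.toLp 2 e)) X *
      (Xᵀ * X + damping A M X • (1 : Matrix (Fin r) (Fin r) ℝ))⁻¹)) ^ 2 ≤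
      (1 - α * muP δ r k / 2) * damping A M X ^ 2 := by
  have hμ := muP_pos (r := r) (k := k) hδ hδ1
  have hη : 0 < damping A M X := by
    refine (damping_nonneg M X).lt_of_ne fun h => ?_
    rw [← h] at hnoise
    have : 0 ≤ 64 * r * ω ^ 2 / (m : ℝ) ^ 2 := by positivity
    linarith
  have hE := (damping_sq (A := A) M X).symm
  generalize damping A M X = η at *
  obtain ⟨D₁, hD₁⟩ := exists_pip_eq hη X ((2 : ℝ) • (bform A (X * Xᵀ - M)).comp (symProd X))
  replace hD₁ : ∀ Y, pip X η D₁ Y = 2 * bform A (X * Xᵀ - M) (symProd X Y) := hD₁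
  set D := grad (loss A (sensing A M + WithLp.toLp 2 e)) X *
    (Xᵀ * X + η • (1 : Matrix (Fin r) (Fin r) ℝ))⁻¹ with hD
  have hD₂ : ∀ Y, pip X η (D - D₁) Y =
      -(2 / (m : ℝ) * fip (∑ i, e i • A i) (symProd X Y)) := fun Y => by
    rw [map_sub, LinearMap.sub_apply, hD, pip_mul_inv hη, fip_grad_loss, hD₁]
    ring
  have h1 := pip_noise_le hη.le hT hD₂
  have hPL := two_mul_muP_mul_sq_le X D₁ hA hM (spectralGap_eigval hM hk hrank)
    (eigval_nonneg hM k) hrank hkr hδ hδ1 hρ hρ1 hρδ hη hE hbasin hD₁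
  have h2 : pip X η (D - D₁) (D - D₁) ≤ muP δ r k * η ^ 2 / 4 := by
    refine h1.trans ?_
    rw [le_div_iff₀ (by norm_num)]
    refine le_of_eq_of_le ?_ hnoise.le
    ring
  have h3 := bform_step_le hδ1 hη hA hE hD₁ hμ.le (muP_le_one hδ hδ1) hPL h2 hα hα1
  rw [add_sub_cancel] at h3
  rwa [damping_sq]

lemma one_sub_mul_muP_nonneg (hδ : 0 ≤ δ) (hδ1 : δ < 1) (hα1 : α ≤ 1 / 4000) :
    0 ≤ 1 - α * muP δ r k / 2 := by
  have h1 := muP_pos (r := r) (k := k) hδ hδ1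
  have h2 := muP_le_one (r := r) (k := k) hδ hδ1
  nlinarith

/-- If the noise matrix `∑ e i • A i` has operator norm at most `ω`, the best iterate has error at
most the larger of the linearly convergent term and the noise level. -/
lemma norm_error_sq_le (hA : RIP A (2 * r) δ) (hk : 0 < k) (hkr : k ≤ r) (hM : M.PosSemidef)
    (hrank : M.rank = k) (hδ : 0 ≤ δ) (hδ1 : δ < 1) (hρ : 0 < ρ) (hρ1 : ρ < 1)
    (hρδ : ρ ^ 2 / (1 - ρ ^ 2) ≤ (1 - δ ^ 2) / 2) (hα : 0 < α) (hα1 : α ≤ 1 / 4000)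
    (hT : ∀ u v : Fin n → ℝ,
      (u ⬝ᵥ (∑ i, e i • A i) *ᵥ v) ^ 2 ≤ ω ^ 2 * ((u ⬝ᵥ u) * (v ⬝ᵥ v)))
    {X : ℕ → Matrix (Fin n) (Fin r) ℝ} {X₀ : Matrix (Fin n) (Fin r) ℝ}
    (hX : X = iterate A M (sensing A M + WithLp.toLp 2 e) α X₀)
    (hbasin : damping A M X₀ ^ 2 < ρ ^ 2 * (1 - δ) * eigval M k ^ 2) {K j : ℕ}
    (hj : ∀ i ≤ K, damping A M (X j) ≤ damping A M (X i)) :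
    ‖X j * (X j)ᵀ - M‖ ^ 2 ≤
      max ((1 + δ) / (1 - δ) * (1 - α * muP δ r k / 2) ^ K * ‖X₀ * X₀ᵀ - M‖ ^ 2)
        (64 * r * ω ^ 2 / (m : ℝ) ^ 2 / (muP δ r k * (1 - δ))) := by
  have hμ := muP_pos (r := r) (k := k) hδ hδ1
  have hq := one_sub_mul_muP_nonneg (r := r) (k := k) hδ hδ1 hα1
  have hq1 : 1 - α * muP δ r k / 2 ≤ 1 := by
    have : 0 < α * muP δ r k := mul_pos hα hμ
    linarith
  have hδ' : 0 < 1 - δ := by linarith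
  have hlow := hA.lower (rank_error_le (X j) hrank hkr)
  rw [← damping_sq] at hlow
  have hle : ∀ i ≤ K, (1 - δ) * ‖X j * (X j)ᵀ - M‖ ^ 2 ≤ damping A M (X i) ^ 2 := fun i hi =>
    hlow.trans (pow_le_pow_left₀ (damping_nonneg M _) (hj i hi) 2)
  by_cases hcase : ∃ i ≤ K, muP δ r k * damping A M (X i) ^ 2 ≤ 64 * r * ω ^ 2 / (m : ℝ) ^ 2
  · obtain ⟨i, hi, hnoise⟩ := hcase
    refine le_max_of_le_right ?_
    rw [le_div_iff₀ (mul_pos hμ hδ')]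
    nlinarith [mul_le_mul_of_nonneg_left (hle i hi) hμ.le]
  · push Not at hcase
    refine le_max_of_le_left ?_
    have hX0 : X 0 = X₀ := by rw [hX]; rfl
    have hstep : ∀ i ≤ K, damping A M (X i) ^ 2 ≤
        (1 - α * muP δ r k / 2) ^ i * damping A M X₀ ^ 2 := by
      intro i
      induction i with
      | zero => intro _; rw [hX0, pow_zero, one_mul]
      | succ i ih =>
        intro hi
        have hi' : i ≤ K := by omega
        have hb : damping A M (X i) ^ 2 < ρ ^ 2 * (1 - δ) * eigval M k ^ 2 := by
          refine ((ih hi').trans ?_).trans_lt hbasin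
          exact mul_le_of_le_one_left (sq_nonneg _) (pow_le_one₀ hq hq1)
        have h := damping_step_sq_le hA hk hkr hM hrank hδ hδ1 hρ hρ1 hρδ hα hα1 hT (X i) hb
          (hcase i hi')
        have hXi : X (i + 1) = X i - α • (grad (loss A (sensing A M + WithLp.toLp 2 e)) (X i) *
            ((X i)ᵀ * X i + damping A M (X i) • (1 : Matrix (Fin r) (Fin r) ℝ))⁻¹) := by
          rw [hX]; rfl
        rw [hXi, pow_succ' (1 - α * muP δ r k / 2), mul_assoc]
        exact h.trans (mul_le_mul_of_nonneg_left (ih hi') hq)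
    have hupp := hA.upper (rank_error_le X₀ hrank hkr)
    rw [← damping_sq] at hupp
    have h1 := (hle K le_rfl).trans ((hstep K le_rfl).trans
      (mul_le_mul_of_nonneg_left hupp (pow_nonneg hq K)))
    rw [div_mul_eq_mul_div, div_mul_eq_mul_div, le_div_iff₀ hδ']
    linarith

end Convergence

/-! ### The operator norm on a grid -/

section Grid

variable {n : ℕ}

/-- A point of the grid of mesh `1 / (4 n)` in the cube `[-1, 1]ⁿ`. -/
noncomputable def gridPoint (z : Fin n → Fin (8 * n + 1)) : Fin n → ℝ :=
  fun i => ((z i : ℝ) - 4 * n) / (4 * n)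

lemma exists_grid_coord (hn : 0 < n) {x : ℝ} (hx : |x| ≤ 1) :
    ∃ j : Fin (8 * n + 1), |((j : ℝ) - 4 * n) / (4 * n)| ≤ |x| ∧
      |x - ((j : ℝ) - 4 * n) / (4 * n)| ≤ 1 / (4 * n) := by
  have hn' : (0 : ℝ) < 4 * n := by positivity
  set k := ⌊4 * n * |x|⌋₊ with hk
  have hk1 : (k : ℝ) ≤ 4 * n * |x| := Nat.floor_le (by positivity)
  have hk2 : 4 * n * |x| < k + 1 := Nat.lt_floor_add_one _
  have hk3 : k ≤ 4 * n := by
    have : (k : ℝ) ≤ ((4 * n : ℕ) : ℝ) := by push_cast; nlinarith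
    exact_mod_cast this
  have h1 : (k : ℝ) / (4 * n) ≤ |x| := by rw [div_le_iff₀ hn']; linarith
  have h2 : |x| - k / (4 * n) ≤ 1 / (4 * n) := by
    rw [sub_le_iff_le_add, ← add_div, le_div_iff₀ hn']; linarith
  rcases le_total 0 x with h | h
  · refine ⟨⟨4 * n + k, by omega⟩, ?_⟩
    have h3 : (((4 * n + k : ℕ) : ℝ) - 4 * n) / (4 * n) = k / (4 * n) := by push_cast; ring
    simp only [h3]
    rw [abs_of_nonneg h] at *
    rw [abs_of_nonneg (by positivity), abs_of_nonneg (by linarith)]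
    exact ⟨h1, h2⟩
  · refine ⟨⟨4 * n - k, by omega⟩, ?_⟩
    have h3 : (((4 * n - k : ℕ) : ℝ) - 4 * n) / (4 * n) = -(k / (4 * n)) := by
      rw [Nat.cast_sub hk3]; push_cast; ring
    simp only [h3]
    rw [abs_of_nonpos h] at *
    rw [abs_neg, abs_of_nonneg (by positivity), abs_of_nonpos (by linarith)]
    exact ⟨h1, by linarith⟩

/-- The grid points of the unit ball form a `1/4`-net of it. -/
lemma exists_gridPoint (hn : 0 < n) {u : Fin n → ℝ} (hu : u ⬝ᵥ u ≤ 1) :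
    ∃ z, gridPoint z ⬝ᵥ gridPoint z ≤ 1 ∧
      ((4 : ℝ) • (u - gridPoint z)) ⬝ᵥ ((4 : ℝ) • (u - gridPoint z)) ≤ 1 := by
  have hu1 : ∀ i, |u i| ≤ 1 := fun i => by
    rw [← sq_le_one_iff_abs_le_one, sq]
    exact (Finset.single_le_sum (f := fun i => u i * u i) (fun j _ => mul_self_nonneg _)
      (Finset.mem_univ i)).trans hu
  choose z hz1 hz2 using fun i => exists_grid_coord hn (hu1 i)
  refine ⟨z, le_trans (Finset.sum_le_sum fun i _ => ?_) hu, ?_⟩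
  · rw [← abs_mul_abs_self, ← abs_mul_abs_self (u i)]
    exact mul_self_le_mul_self (abs_nonneg _) (hz1 i)
  · have hn1 : (1 : ℝ) ≤ n := by exact_mod_cast hn
    have h1 : ∀ i, ((4 : ℝ) • (u - gridPoint z)) i * ((4 : ℝ) • (u - gridPoint z)) i ≤
        1 / (n : ℝ) ^ 2 := fun i => by
      have h2 := pow_le_pow_left₀ (abs_nonneg _) (hz2 i) 2
      rw [sq_abs] at h2
      calc ((4 : ℝ) • (u - gridPoint z)) i * ((4 : ℝ) • (u - gridPoint z)) i
          = 16 * (u i - ((z i : ℝ) - 4 * n) / (4 * n)) ^ 2 := by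
            simp only [Pi.smul_apply, Pi.sub_apply, smul_eq_mul, gridPoint]; ring
        _ ≤ 16 * (1 / (4 * n)) ^ 2 := by linarith
        _ = 1 / (n : ℝ) ^ 2 := by field_simp; norm_num
    refine (Finset.sum_le_sum fun i _ => h1 i).trans ?_
    rw [Finset.sum_const, Finset.card_univ, Fintype.card_fin, nsmul_eq_mul, mul_one_div,
      div_le_one (by positivity)]
    nlinarith

/-- A bilinear form bounded by `τ` on the grid points of the unit ball is bounded by `2 τ` on the
unit ball: at a maximizer the value `W` satisfies `W ≤ τ + W / 4 + W / 4`. -/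
lemma dotProduct_mulVec_le_of_grid (hn : 0 < n) {T : Matrix (Fin n) (Fin n) ℝ} {τ : ℝ}
    (hT : ∀ z z', gridPoint z ⬝ᵥ gridPoint z ≤ 1 → gridPoint z' ⬝ᵥ gridPoint z' ≤ 1 →
      gridPoint z ⬝ᵥ T *ᵥ gridPoint z' ≤ τ) {u v : Fin n → ℝ} (hu : u ⬝ᵥ u ≤ 1)
    (hv : v ⬝ᵥ v ≤ 1) : u ⬝ᵥ T *ᵥ v ≤ 2 * τ := by
  have hcont : Continuous fun u : Fin n → ℝ => u ⬝ᵥ u := by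
    simp only [dotProduct]; fun_prop
  have hS : IsCompact {u : Fin n → ℝ | u ⬝ᵥ u ≤ 1} := by
    refine (isCompact_Icc (a := fun _ : Fin n => (-1 : ℝ)) (b := fun _ => 1)).of_isClosed_subset
      (isClosed_le hcont continuous_const) fun w hw => ?_
    have hw1 : ∀ i, |w i| ≤ 1 := fun i => by
      rw [← sq_le_one_iff_abs_le_one, sq]
      exact (Finset.single_le_sum (f := fun i => w i * w i) (fun j _ => mul_self_nonneg _)
        (Finset.mem_univ i)).trans hw
    exact ⟨fun i => (abs_le.1 (hw1 i)).1, fun i => (abs_le.1 (hw1 i)).2⟩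
  obtain ⟨⟨a, b⟩, ⟨ha, hb⟩, hmax⟩ := (hS.prod hS).exists_isMaxOn ⟨(u, v), hu, hv⟩
    (f := fun p : (Fin n → ℝ) × (Fin n → ℝ) => p.1 ⬝ᵥ T *ᵥ p.2)
    (by simp only [dotProduct, Matrix.mulVec]; fun_prop)
  have hmax' : ∀ p q : Fin n → ℝ, p ⬝ᵥ p ≤ 1 → q ⬝ᵥ q ≤ 1 → p ⬝ᵥ T *ᵥ q ≤ a ⬝ᵥ T *ᵥ b :=
    fun p q hp hq => hmax (show (p, q) ∈ _ from ⟨hp, hq⟩)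
  obtain ⟨z, hz1, hz2⟩ := exists_gridPoint hn ha
  obtain ⟨z', hz1', hz2'⟩ := exists_gridPoint hn hb
  have h1 := hT z z' hz1 hz1'
  have h2 := hmax' _ _ hz2 hb
  have h3 := hmax' _ _ hz1 hz2'
  simp only [smul_dotProduct, sub_dotProduct, Matrix.mulVec_smul, Matrix.mulVec_sub,
    dotProduct_smul, dotProduct_sub, smul_eq_mul] at h2 h3
  linarith [hmax' u v hu hv]

lemma dotProduct_mulVec_sq_le_of_grid (hn : 0 < n) {T : Matrix (Fin n) (Fin n) ℝ} {τ : ℝ}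
    (hT : ∀ z z', gridPoint z ⬝ᵥ gridPoint z ≤ 1 → gridPoint z' ⬝ᵥ gridPoint z' ≤ 1 →
      gridPoint z ⬝ᵥ T *ᵥ gridPoint z' ≤ τ) (u v : Fin n → ℝ) :
    (u ⬝ᵥ T *ᵥ v) ^ 2 ≤ (2 * τ) ^ 2 * ((u ⬝ᵥ u) * (v ⬝ᵥ v)) := by
  have hnn : ∀ w : Fin n → ℝ, 0 ≤ w ⬝ᵥ w := fun w => by
    simpa using dotProduct_star_self_nonneg w
  rcases (hnn u).eq_or_lt with h | hu
  · rw [dotProduct_self_eq_zero.1 h.symm]; simp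
  rcases (hnn v).eq_or_lt with h | hv
  · rw [dotProduct_self_eq_zero.1 h.symm]; simp
  set a := √(u ⬝ᵥ u) with ha
  set b := √(v ⬝ᵥ v) with hb
  have ha0 : 0 < a := Real.sqrt_pos.2 hu
  have hb0 : 0 < b := Real.sqrt_pos.2 hv
  have ha2 : a * a = u ⬝ᵥ u := Real.mul_self_sqrt hu.le
  have hb2 : b * b = v ⬝ᵥ v := Real.mul_self_sqrt hv.le
  have hu1 : (a⁻¹ • u) ⬝ᵥ (a⁻¹ • u) ≤ 1 := by
    rw [smul_dotProduct, dotProduct_smul, ← ha2, smul_eq_mul, smul_eq_mul]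
    field_simp; exact le_rfl
  have hv1 : (b⁻¹ • v) ⬝ᵥ (b⁻¹ • v) ≤ 1 := by
    rw [smul_dotProduct, dotProduct_smul, ← hb2, smul_eq_mul, smul_eq_mul]
    field_simp; exact le_rfl
  have h1 := dotProduct_mulVec_le_of_grid hn hT hu1 hv1
  have h2 := dotProduct_mulVec_le_of_grid hn hT (u := -(a⁻¹ • u)) (by simpa using hu1) hv1
  rw [neg_dotProduct] at h2
  have h3 : u ⬝ᵥ T *ᵥ v = a * b * ((a⁻¹ • u) ⬝ᵥ T *ᵥ (b⁻¹ • v)) := by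
    rw [smul_dotProduct, Matrix.mulVec_smul, dotProduct_smul, smul_eq_mul, smul_eq_mul]
    field_simp
  have h4 : ((a⁻¹ • u) ⬝ᵥ T *ᵥ (b⁻¹ • v)) ^ 2 ≤ (2 * τ) ^ 2 := by
    rw [← sq_abs]
    exact pow_le_pow_left₀ (abs_nonneg _) (abs_le.2 ⟨by linarith, h1⟩) 2
  rw [h3, ← ha2, ← hb2]
  nlinarith [mul_le_mul_of_nonneg_left h4 (sq_nonneg (a * b))]

end Grid

/-! ### Concentration of the noise -/

section Probability

/-- A sub-Gaussian variance proxy can be increased. -/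
lemma hasSubgaussianMGF_mono {Ω : Type*} [MeasurableSpace Ω] {P : Measure Ω} {X : Ω → ℝ}
    {c d : ℝ≥0} (h : HasSubgaussianMGF X c P) (hcd : c ≤ d) :
    HasSubgaussianMGF X d P where
  integrable_exp_mul := h.integrable_exp_mul
  mgf_le t := (h.mgf_le t).trans (Real.exp_le_exp.2 (by gcongr))

variable {n m r : ℕ} {A : Fin m → Matrix (Fin n) (Fin n) ℝ} {δ τ : ℝ}
  {Ω : Type*} [MeasurableSpace Ω] {P : Measure Ω} {ε : Fin m → Ω → ℝ}
  {c : ℝ≥0}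

/-- The Chernoff bound for the noise matrix `∑ ε i • A i` tested against unit vectors. The
restricted isometry property for matrices of rank one bounds the variance proxy by `2 m c`. -/
lemma measureReal_noise_ge_le (hA : RIP A (2 * r) δ) (hr : 0 < r) (hδ1 : δ < 1) (hm : 0 < m)
    (hind : iIndepFun ε P) (hsub : ∀ i, HasSubgaussianMGF (ε i) c P) (hτ : 0 ≤ τ)
    {u v : Fin n → ℝ} (hu : u ⬝ᵥ u ≤ 1) (hv : v ⬝ᵥ v ≤ 1) :
    P.real {ω | τ ≤ u ⬝ᵥ (∑ i, ε i ω • A i) *ᵥ v} ≤ Real.exp (-τ ^ 2 / (2 * (2 * m * c))) := by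
  set F := Matrix.vecMulVec u v with hF
  have hsum : HasSubgaussianMGF (fun ω => ∑ i, sensing A F i * ε i ω)
      (∑ i, (sensing A F i ^ 2).toNNReal * c) P :=
    HasSubgaussianMGF.sum_of_iIndepFun
      (hind.comp (fun i x => sensing A F i * x) fun i => by fun_prop)
      fun i _ => by
        rw [Real.toNNReal_of_nonneg (sq_nonneg _)]
        exact (hsub i).const_mul _
  have hle : ∑ i, (sensing A F i ^ 2).toNNReal * c ≤ 2 * m * c := by
    have hm' : (0 : ℝ) < m := Nat.cast_pos.2 hm
    have h1 := (hA F ((Matrix.rank_vecMulVec_le u v).trans (by omega))).2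
    have h2 : ‖F‖ ^ 2 ≤ 1 := by
      rw [hF, norm_vecMulVec_sq]
      exact mul_le_one₀ hu (by simpa using dotProduct_star_self_nonneg v) hv
    have h3 : ‖sensing A F‖ ^ 2 ≤ 2 * m := by
      rw [one_div, inv_mul_le_iff₀ hm'] at h1
      have h4 : (1 + δ) * ‖F‖ ^ 2 ≤ 2 := by nlinarith [sq_nonneg ‖F‖]
      nlinarith [mul_le_mul_of_nonneg_left h4 hm'.le]
    rw [EuclideanSpace.norm_sq_eq] at h3
    simp only [Real.norm_eq_abs, sq_abs] at h3
    rw [← Finset.sum_mul, ← NNReal.coe_le_coe]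
    push_cast
    simp only [Real.coe_toNNReal _ (sq_nonneg _)]
    exact mul_le_mul_of_nonneg_right h3 c.2
  have h := (hasSubgaussianMGF_mono hsum hle).measure_ge_le hτ
  have heq : ∀ ω, u ⬝ᵥ (∑ i, ε i ω • A i) *ᵥ v = ∑ i, sensing A F i * ε i ω := fun ω => by
    rw [← fip_vecMulVec, ← hF]
    simp [sensing_apply, mul_comm]
  simp only [heq]
  simpa using h

/-- The number of pairs of grid points, against the Chernoff bound at the level
`τ² = 44 c m n log n`. -/
lemma card_grid_mul_exp_le (hn : 2 ≤ n) :
    (((8 * n + 1 : ℕ) : ℝ) ^ n * ((8 * n + 1 : ℕ) : ℝ) ^ n) * Real.exp (-(11 * (n * Real.log n))) ≤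
      (n : ℝ)⁻¹ := by
  have hn' : (0 : ℝ) < n := by positivity
  have h1 : ((8 * n + 1 : ℕ) : ℝ) ≤ (n : ℝ) ^ 5 := by
    have h2 : 16 ≤ n ^ 4 := by
      calc 16 = 2 ^ 4 := by norm_num
        _ ≤ n ^ 4 := Nat.pow_le_pow_left hn 4
    have : 8 * n + 1 ≤ n ^ 5 := by
      calc 8 * n + 1 ≤ 16 * n := by omega
        _ ≤ n ^ 4 * n := Nat.mul_le_mul_right n h2
        _ = n ^ 5 := by ring
    exact_mod_cast this
  have h2 : (n : ℝ) ^ 5 = Real.exp (5 * Real.log n) := by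
    rw [mul_comm, Real.exp_mul, Real.exp_log hn']; norm_cast
  have h3 : ((8 * n + 1 : ℕ) : ℝ) ^ n ≤ Real.exp (5 * (n * Real.log n)) := by
    calc ((8 * n + 1 : ℕ) : ℝ) ^ n ≤ ((n : ℝ) ^ 5) ^ n := pow_le_pow_left₀ (by positivity) h1 n
      _ = Real.exp (5 * (n * Real.log n)) := by rw [h2, ← Real.exp_nat_mul]; ring_nf
  have hlog : 0 ≤ Real.log n := Real.log_nonneg (by exact_mod_cast (by omega : 1 ≤ n))
  calc _ ≤ (Real.exp (5 * (n * Real.log n)) * Real.exp (5 * (n * Real.log n))) *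
        Real.exp (-(11 * (n * Real.log n))) := by gcongr
    _ = Real.exp (-(n * Real.log n)) := by rw [← Real.exp_add, ← Real.exp_add]; ring_nf
    _ ≤ Real.exp (-Real.log n) := by
      refine Real.exp_le_exp.2 (neg_le_neg ?_)
      have : (1 : ℝ) ≤ n := by exact_mod_cast (by omega : 1 ≤ n)
      nlinarith
    _ = (n : ℝ)⁻¹ := by rw [Real.exp_neg, Real.exp_log hn']

/-- With probability at least `1 - 1 / n` the noise matrix has operator norm at most `2 τ`, where
`τ² = 44 c m n log n`. -/
lemma measure_noise_large_le [IsProbabilityMeasure P] (hA : RIP A (2 * r) δ) (hr : 0 < r)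
    (hδ1 : δ < 1) (hm : 0 < m)
    (hn : 2 ≤ n) (hind : iIndepFun ε P) (hc : 0 < c)
    (hsub : ∀ i, HasSubgaussianMGF (ε i) c P) (hτ : 0 ≤ τ)
    (hτ2 : τ ^ 2 = 44 * c * m * (n * Real.log n)) :
    P {ω | ¬ ∀ u v : Fin n → ℝ, (u ⬝ᵥ (∑ i, ε i ω • A i) *ᵥ v) ^ 2 ≤
      (2 * τ) ^ 2 * ((u ⬝ᵥ u) * (v ⬝ᵥ v))} ≤ ENNReal.ofReal (n : ℝ)⁻¹ := by
  have hpt : ∀ z z' : Fin n → Fin (8 * n + 1),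
      P {ω | gridPoint z ⬝ᵥ gridPoint z ≤ 1 ∧ gridPoint z' ⬝ᵥ gridPoint z' ≤ 1 ∧
        τ ≤ gridPoint z ⬝ᵥ (∑ i, ε i ω • A i) *ᵥ gridPoint z'} ≤
      ENNReal.ofReal (Real.exp (-(11 * (n * Real.log n)))) := by
    intro z z'
    by_cases hz : gridPoint z ⬝ᵥ gridPoint z ≤ 1 ∧ gridPoint z' ⬝ᵥ gridPoint z' ≤ 1
    · have h := measureReal_noise_ge_le hA hr hδ1 hm hind hsub hτ hz.1 hz.2
      have hexp : -τ ^ 2 / (2 * (2 * m * c)) = -(11 * (n * Real.log n)) := by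
        have hm' : (m : ℝ) ≠ 0 := by positivity
        have hc' : (c : ℝ) ≠ 0 := by positivity
        rw [hτ2]; field_simp; ring
      rw [hexp] at h
      simp only [hz, true_and]
      rw [← ofReal_measureReal]
      exact ENNReal.ofReal_le_ofReal h
    · have : {ω | gridPoint z ⬝ᵥ gridPoint z ≤ 1 ∧ gridPoint z' ⬝ᵥ gridPoint z' ≤ 1 ∧
          τ ≤ gridPoint z ⬝ᵥ (∑ i, ε i ω • A i) *ᵥ gridPoint z'} = ∅ :=
        Set.eq_empty_of_forall_notMem fun ω hω => hz ⟨hω.1, hω.2.1⟩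
      rw [this]; simp
  calc _ ≤ P (⋃ p ∈ (Finset.univ : Finset ((Fin n → Fin (8 * n + 1)) × (Fin n → Fin (8 * n + 1)))),
        {ω | gridPoint p.1 ⬝ᵥ gridPoint p.1 ≤ 1 ∧ gridPoint p.2 ⬝ᵥ gridPoint p.2 ≤ 1 ∧
          τ ≤ gridPoint p.1 ⬝ᵥ (∑ i, ε i ω • A i) *ᵥ gridPoint p.2}) := by
        refine measure_mono fun ω hω => ?_
        by_contra hcon
        refine hω (dotProduct_mulVec_sq_le_of_grid (by omega) fun z z' hz hz' => ?_)
        by_contra! hlt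
        exact hcon (Set.mem_iUnion₂.2 ⟨(z, z'), Finset.mem_univ _, hz, hz', hlt.le⟩)
    _ ≤ ∑ p : (Fin n → Fin (8 * n + 1)) × (Fin n → Fin (8 * n + 1)),
        ENNReal.ofReal (Real.exp (-(11 * (n * Real.log n)))) :=
        (measure_biUnion_finset_le _ _).trans (Finset.sum_le_sum fun p _ => hpt p.1 p.2)
    _ = ENNReal.ofReal ((((8 * n + 1 : ℕ) : ℝ) ^ n * ((8 * n + 1 : ℕ) : ℝ) ^ n) *
          Real.exp (-(11 * (n * Real.log n)))) := by
        rw [Finset.sum_const, Finset.card_univ, Fintype.card_prod, Fintype.card_fun,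
          Fintype.card_fin, Fintype.card_fin, nsmul_eq_mul, ENNReal.ofReal_mul (by positivity)]
        congr 1
        rw [← Nat.cast_pow, ← Nat.cast_mul, ENNReal.ofReal_natCast]
    _ ≤ ENNReal.ofReal (n : ℝ)⁻¹ := ENNReal.ofReal_le_ofReal (card_grid_mul_exp_le hn)

end Probability

end PrecGD

/-! ### Convergence with high probability -/

theorem theorem7 :
    -- `L` depends only on `δ`
    ∃ L : ℝ → ℝ, (∀ δ : ℝ, 0 ≤ δ → δ < 1 → 0 < L δ) ∧
    -- the constants depend only on the ratio `κ` of the sub-Gaussian variance proxy to `σ²`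
    ∀ κ : ℝ≥0, ∃ C c c' : ℝ, 0 < C ∧ 0 < c ∧ 0 < c' ∧
    ∀ (n m r rstar : ℕ) (δ ρ : ℝ) (A : Fin m → Matrix (Fin n) (Fin n) ℝ)
      (Mstar : Matrix (Fin n) (Fin n) ℝ)
      (Ω : Type*) [MeasurableSpace Ω] (P : Measure Ω) [IsProbabilityMeasure P]
      (ε : Fin m → Ω → ℝ) (σ : ℝ≥0) (α : ℝ) (K : ℕ),
      0 < m →
      -- the ground truth: positive semidefinite, of rank `rstar`
      0 < rstar → rstar ≤ r → Mstar.PosSemidef → Mstar.rank = rstar →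
      -- the measurements
      0 ≤ δ → δ < 1 → PrecGD.RIP A (2 * r) δ →
      -- the noise: independent, centred, sub-Gaussian entries of average variance `σ²`
      iIndepFun ε P →
      (∀ i, ∫ ω, ε i ω ∂P = 0) →
      (σ : ℝ) ^ 2 = (1 / (m : ℝ)) * ∑ i, ∫ ω, (ε i ω) ^ 2 ∂P →
      (∀ i, HasSubgaussianMGF (ε i) (κ * σ ^ 2) P) →
      -- the radius of the basin and the step size
      0 < ρ → ρ < 1 → ρ ^ 2 / (1 - ρ ^ 2) ≤ (1 - δ ^ 2) / 2 →
      0 < α → α ≤ 1 / L δ →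
      -- the exceptional event has probability at most `c n^{-c'}`
      P {ω | ¬ ∀ X₀ : Matrix (Fin n) (Fin r) ℝ,
          (1 / (m : ℝ)) * ‖PrecGD.sensing A (X₀ * X₀ᵀ - Mstar)‖ ^ 2
            < ρ ^ 2 * (1 - δ) * PrecGD.eigval Mstar rstar ^ 2 →
          ∀ X : ℕ → Matrix (Fin n) (Fin r) ℝ,
          X = PrecGD.iterate A Mstar
            (PrecGD.sensing A Mstar + WithLp.toLp 2 (fun i => ε i ω)) α X₀ →
          ∀ kstar ≤ K,
          (∀ k ≤ K, PrecGD.damping A Mstar (X kstar) ≤ PrecGD.damping A Mstar (X k)) →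
          ‖X kstar * (X kstar)ᵀ - Mstar‖ ^ 2 ≤
            C * max ((1 + δ) / (1 - δ) * (1 - α * PrecGD.muP δ r rstar / 2) ^ K *
                ‖X₀ * X₀ᵀ - Mstar‖ ^ 2)
              (PrecGD.statError σ δ n m r rstar)}
        ≤ ENNReal.ofReal (c * (n : ℝ) ^ (-c')) := by
  refine ⟨fun _ => 4000, fun _ _ _ => by norm_num, fun κ =>
    ⟨11264 * (κ + 1), 1, 1, by positivity, one_pos, one_pos, ?_⟩⟩
  intro n m r rstar δ ρ A Mstar Ω _ P _ ε σ α K hm hrs hrr hM hrank hδ hδ1 hA hind _ _ hsub hρ hρ1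
    hρδ hα hα1
  rw [one_mul, Real.rpow_neg_one]
  have hm' : (0 : ℝ) < m := Nat.cast_pos.2 hm
  have hn1 : 1 ≤ n := by
    have := Mstar.rank_le_width
    omega
  have hlog : 0 ≤ Real.log n := Real.log_nonneg (by exact_mod_cast hn1)
  rcases hn1.eq_or_lt with rfl | hn2
  · -- for `n = 1` the asserted bound on the probability is `1`
    simpa using prob_le_one
  obtain ⟨τ, hτ, hτ2⟩ : ∃ τ : ℝ, 0 ≤ τ ∧
      τ ^ 2 = 44 * ((κ + 1) * σ ^ 2 : ℝ≥0) * m * (n * Real.log n) :=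
    ⟨_, Real.sqrt_nonneg _, Real.sq_sqrt (by positivity)⟩
  refine le_trans (measure_mono (t := {ω | ¬ ∀ u v : Fin n → ℝ,
    (u ⬝ᵥ (∑ i, ε i ω • A i) *ᵥ v) ^ 2 ≤ (2 * τ) ^ 2 * ((u ⬝ᵥ u) * (v ⬝ᵥ v))})
    fun ω hω hT => hω ?_) ?_
  · intro X₀ hX₀ X hX kstar _ hmin
    rw [← PrecGD.bform_self, ← PrecGD.damping_sq] at hX₀
    refine (PrecGD.norm_error_sq_le hA hrs hrr hM hrank hδ hδ1 hρ hρ1 hρδ hα hα1 hT hX hX₀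
      hmin).trans ?_
    have hμ := PrecGD.muP_pos (r := r) (k := rstar) hδ hδ1
    have hδ' : 0 < 1 - δ := by linarith
    have hq := PrecGD.one_sub_mul_muP_nonneg (r := r) (k := rstar) hδ hδ1 hα1
    have hstat : 64 * r * (2 * τ) ^ 2 / (m : ℝ) ^ 2 / (PrecGD.muP δ r rstar * (1 - δ)) =
        11264 * (κ + 1) * PrecGD.statError σ δ n m r rstar := by
      rw [mul_pow, hτ2, PrecGD.statError]
      push_cast
      field_simp
      ring
    rw [hstat, mul_max_of_nonneg _ _ (by positivity)]
    refine max_le_max_right _ (le_mul_of_one_le_left (by positivity) ?_)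
    have : (0 : ℝ) ≤ κ := κ.2
    linarith
  · have hmono : ∀ i, HasSubgaussianMGF (ε i) ((κ + 1) * σ ^ 2) P := fun i =>
      PrecGD.hasSubgaussianMGF_mono (hsub i)
        (mul_le_mul_left (le_add_of_nonneg_right zero_le_one) _)
    rcases eq_or_ne σ 0 with rfl | hσ
    · -- without variance the noise vanishes almost surely
      have hzero : ∀ᵐ ω ∂P, ∀ i, ε i ω = 0 := by
        rw [ae_all_iff]
        intro i
        have h := hmono i
        simp only [ne_eq, OfNat.ofNat_ne_zero, not_false_eq_true, zero_pow, mul_zero] at h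
        exact h.ae_eq_zero_of_hasSubgaussianMGF_zero
      refine le_of_eq_of_le (ae_iff.1 ?_) zero_le
      filter_upwards [hzero] with ω hω u v
      simp only [hω, zero_smul, Finset.sum_const_zero, Matrix.zero_mulVec, dotProduct_zero]
      have hu : 0 ≤ u ⬝ᵥ u := by simpa using dotProduct_star_self_nonneg u
      have hv : 0 ≤ v ⬝ᵥ v := by simpa using dotProduct_star_self_nonneg v
      rw [zero_pow two_ne_zero]
      positivity
    · exact PrecGD.measure_noise_large_le hA (hrs.trans_le hrr) hδ1 hm hn2 hind
        (by positivity) hmono hτ hτ2
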